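/- Let $\Omega\subset\mathbb{R}^n$ be a bounded open set (for instance a bounded Lipschitz domain with $n\in\{2,3\}$). Let $a_{ij}=a_{ji}\in C^{0,1}(\bar\Omega)$ satisfy, for some $\sigma>0$, $\sum_{i,j}a_{ij}(x)\xi_i\xi_j\ge\sigma|\xi|^2$ for almost all $x\in\Omega$ and all $\xi\in\mathbb{R}^n$; let $c_0\in L^\infty(\Omega)$, $f,y_d\in L^2(\Omega)$, and $\alpha,\beta,\varepsilon,M>0$, $p>1$. For $y\in H^1_0(\Omega)$ and $u\in L^2(\Omega)$, the state equation $Ay=u+f$ in $\Omega$, $y=0$ on $\partial\Omega$, means $$\int_\Omega\Big(\sum_{i,j}a_{ij}\,\partial_jy\,\partial_iv+c_0\,y\,v\Big)dx=\int_\Omega(u+f)v\,dx\qquad\text{for all } v\in H^1_0(\Omega).$$ For $\gamma>0$ let $h_{p,\gamma}(v)=\frac{\gamma^{p-1}}{p}|v|^p$ if $|v|\le\frac1\gamma$ and $h_{p,\gamma}(v)=|v|+\frac1\gamma\frac{1-p}{p}$ otherwise, and set $$J(y,u)=\tfrac12\|y-y_d\|_{L^2(\Omega)}^2+\tfrac\alpha2\|u\|_{L^2(\Omega)}^2+\beta\int_\Omega|u|^{1/p}dx,$$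 $$J_\gamma(y,u)=\tfrac12\|y-y_d\|_{L^2(\Omega)}^2+\tfrac\alpha2\|u\|_{L^2(\Omega)}^2+\beta\int_\Omega h_{p,\gamma}(u)^{1/p}dx .$$ Let $X$ be $L^2(\Omega)$ or $H^1_0(\Omega)$ (no boundary condition, or the homogeneous Dirichlet condition, in the definition of the admissible controls) and let $$U_{ad}=\Big\{u\in X:\ \Delta u\in H^{-1}(\Omega),\ \exists v\in L^2(\Omega),\ \|v\|_{L^2(\Omega)}\le M,\ -\Delta u+\tfrac1\varepsilon u=\tfrac1\varepsilon v\Big\},$$ where the equation holds in the sense of distributions on $\Omega$. Consider the problems of minimizing $J$ (problem $(P)$) and $J_\gamma$ (problem $(P_\gamma)$) over all pairs $(y,u)\in H^1_0(\Omega)\times U_{ad}$ satisfying the state equation. (If the state equation has exactly one solution $y$ for every $u$, then $J(y,u)$ and $J_\gamma(y,u)$ are the usual reduced functionals $J(u)$ and $J_\gamma(u)$.) For every $\gamma>0$ let $(\bar y_\gamma,\bar u_\gamma)$ be a global solution of $(P_\gamma)$. Then: 1. There are $\gamma_k>0$ with $\gamma_k\to\infty$ such that $\bar u_{\gamma_k}$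 converges strongly in $L^2(\Omega)$ to some $u^*\in U_{ad}$. 2. Whenever $\gamma_k>0$, $\gamma_k\to\infty$ and $\bar u_{\gamma_k}\to u^*$ strongly in $L^2(\Omega)$, one has $u^*\in U_{ad}$, and there is $y^*\in H^1_0(\Omega)$ such that $(y^*,u^*)$ is a global solution of $(P)$ and $$\lim_{k\to\infty}J_{\gamma_k}(\bar y_{\gamma_k},\bar u_{\gamma_k})=J(y^*,u^*)=\inf(P).$$ If, moreover, every $(\bar y_{\gamma_k},\bar u_{\gamma_k})$ also minimizes $J_{\gamma_k}$ over all pairs $(y,u)\in H^1_0(\Omega)\times L^2(\Omega)$ satisfying the state equation, then $(y^*,u^*)$ minimizes $J$ over all these pairs as well, and $J(y^*,u^*)$ is the infimum of $J$ over them. -/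

import Mathlib

open MeasureTheory Filter Topology
open scoped ContDiff

noncomputable section

namespace SparseControl

/-- The real Hilbert space `L²(Ω)` for a set `Ω ⊆ ℝⁿ` with Lebesgue measure. -/
abbrev L2 {n : ℕ} (Ω : Set (EuclideanSpace ℝ (Fin n))) : Type :=
  Lp ℝ 2 (volume.restrict Ω)

/-- Test functions: `φ ∈ C_c^∞(Ω)`, extended by zero to `ℝⁿ`. -/
def IsTest {n : ℕ} (Ω : Set (EuclideanSpace ℝ (Fin n)))
    (φ : EuclideanSpace ℝ (Fin n) → ℝ) : Prop :=
  ContDiff ℝ ∞ φ ∧ HasCompactSupport φ ∧ tsupport φ ⊆ Ω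

/-- The classical partial derivative `∂φ/∂x_i` at `x`. -/
def pd {n : ℕ} (i : Fin n) (φ : EuclideanSpace ℝ (Fin n) → ℝ)
    (x : EuclideanSpace ℝ (Fin n)) : ℝ :=
  fderiv ℝ φ x (EuclideanSpace.single i 1)

/-- The pairs `(y, ∇y)` with `y ∈ H¹₀(Ω)`: the closure of `{(φ, ∇φ) : φ ∈ C_c^∞(Ω)}` in
`L²(Ω) × L²(Ω)ⁿ`, that is, the closure of `C_c^∞(Ω)` in the `H¹` norm, each limit being
recorded together with its weak gradient. -/
def H10Graph {n : ℕ} (Ω : Set (EuclideanSpace ℝ (Fin n))) :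
    Set (L2 Ω × (Fin n → L2 Ω)) :=
  closure {z | ∃ φ, IsTest Ω φ ∧ z.1 =ᵐ[volume.restrict Ω] φ ∧
    ∀ i, z.2 i =ᵐ[volume.restrict Ω] pd i φ}

/-- The Sobolev space `H¹₀(Ω)` as a set of elements of `L²(Ω)`. -/
def H10 {n : ℕ} (Ω : Set (EuclideanSpace ℝ (Fin n))) : Set (L2 Ω) :=
  {y | ∃ g, (y, g) ∈ H10Graph Ω}

/-- `y ∈ H¹₀(Ω)` is a weak solution of `A y = w` in `Ω`, `y = 0` on the boundary, where
`A y = - ∑ᵢⱼ ∂ᵢ(aᵢⱼ ∂ⱼ y) + c₀ y`: for every `v ∈ H¹₀(Ω)`,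
`∫_Ω ∑ᵢⱼ aᵢⱼ ∂ⱼy ∂ᵢv + c₀ y v = ∫_Ω w v`. -/
def IsWeakSolution {n : ℕ} (Ω : Set (EuclideanSpace ℝ (Fin n)))
    (a : Fin n → Fin n → EuclideanSpace ℝ (Fin n) → ℝ)
    (c₀ : EuclideanSpace ℝ (Fin n) → ℝ) (y w : L2 Ω) : Prop :=
  ∃ g : Fin n → L2 Ω, (y, g) ∈ H10Graph Ω ∧
    ∀ (v : L2 Ω) (h : Fin n → L2 Ω), (v, h) ∈ H10Graph Ω →
      ∫ x in Ω, ((∑ i, ∑ j, a i j x * g j x * h i x) + c₀ x * y x * v x)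
        = ∫ x in Ω, w x * v x

/-- The distributional Laplacian of `u ∈ L²(Ω)` belongs to `H⁻¹(Ω)`: it is a functional on
`C_c^∞(Ω)` that is bounded in the `H¹` norm. -/
def LaplacianMemHneg1 {n : ℕ} (Ω : Set (EuclideanSpace ℝ (Fin n))) (u : L2 Ω) : Prop :=
  ∃ C : ℝ, ∀ φ, IsTest Ω φ →
    |∫ x in Ω, u x * Laplacian.laplacian φ x|
      ≤ C * Real.sqrt ((∫ x in Ω, φ x ^ 2) + ∑ i, ∫ x in Ω, pd i φ x ^ 2)

/-- `-Δu + (1/ε) u = (1/ε) v` in the sense of distributions on `Ω`. -/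
def HelmholtzEq {n : ℕ} (Ω : Set (EuclideanSpace ℝ (Fin n))) (ε : ℝ) (u v : L2 Ω) : Prop :=
  ∀ φ, IsTest Ω φ →
    ∫ x in Ω, (-(u x * Laplacian.laplacian φ x) + (1 / ε) * u x * φ x)
      = ∫ x in Ω, (1 / ε) * v x * φ x

/-- The set of admissible controls `U_ad`, inside a set `X` of `L²` functions (`X = L²(Ω)`, or
`X = H¹₀(Ω)` when the elliptic equation for `u` carries the homogeneous Dirichlet condition):
all `u ∈ X` with `Δu ∈ H⁻¹(Ω)` for which there is `v` in the closed `L²` ball of radius `M` with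
`-Δu + (1/ε) u = (1/ε) v`. -/
def Uad {n : ℕ} (Ω : Set (EuclideanSpace ℝ (Fin n))) (X : Set (L2 Ω)) (ε M : ℝ) :
    Set (L2 Ω) :=
  {u | u ∈ X ∧ LaplacianMemHneg1 Ω u ∧
    ∃ v ∈ Metric.closedBall (0 : L2 Ω) M, HelmholtzEq Ω ε u v}

/-- The Huber-type regularization `h_{p,γ}` of the absolute value. -/
def huber (p γ v : ℝ) : ℝ :=
  if v ∈ Set.Icc (-(1 / γ)) (1 / γ) then γ ^ (p - 1) / p * |v| ^ p
  else |v| + 1 / γ * ((1 - p) / p)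

/-- `Υ_p(u) = ∫_Ω |u|^{1/p}`. -/
def Upsilon {n : ℕ} {Ω : Set (EuclideanSpace ℝ (Fin n))} (p : ℝ) (u : L2 Ω) : ℝ :=
  ∫ x in Ω, |u x| ^ (1 / p)

/-- `Υ_{p,γ}(u) = ∫_Ω h_{p,γ}(u)^{1/p}`. -/
def UpsilonReg {n : ℕ} {Ω : Set (EuclideanSpace ℝ (Fin n))} (p γ : ℝ) (u : L2 Ω) : ℝ :=
  ∫ x in Ω, huber p γ (u x) ^ (1 / p)

/-- The cost `½ ‖y - y_d‖² + (α/2) ‖u‖² + β Υ_p(u)` of a state-control pair `z = (y, u)`. -/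
def cost {n : ℕ} {Ω : Set (EuclideanSpace ℝ (Fin n))} (yd : L2 Ω) (α β p : ℝ)
    (z : L2 Ω × L2 Ω) : ℝ :=
  1 / 2 * ‖z.1 - yd‖ ^ 2 + α / 2 * ‖z.2‖ ^ 2 + β * Upsilon p z.2

/-- The regularized cost `½ ‖y - y_d‖² + (α/2) ‖u‖² + β Υ_{p,γ}(u)` of `z = (y, u)`. -/
def costReg {n : ℕ} {Ω : Set (EuclideanSpace ℝ (Fin n))} (yd : L2 Ω) (α β p γ : ℝ)
    (z : L2 Ω × L2 Ω) : ℝ :=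
  1 / 2 * ‖z.1 - yd‖ ^ 2 + α / 2 * ‖z.2‖ ^ 2 + β * UpsilonReg p γ z.2

/-- Feasible state-control pairs `(y, u)`: the control `u` lies in `U`, and `y ∈ H¹₀(Ω)` is a weak
solution of `A y = u + f`. -/
def Feasible {n : ℕ} (Ω : Set (EuclideanSpace ℝ (Fin n)))
    (a : Fin n → Fin n → EuclideanSpace ℝ (Fin n) → ℝ)
    (c₀ : EuclideanSpace ℝ (Fin n) → ℝ) (f : L2 Ω) (U : Set (L2 Ω)) : Set (L2 Ω × L2 Ω) :=
  {z | z.2 ∈ U ∧ IsWeakSolution Ω a c₀ z.1 (z.2 + f)}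

/-- `z` is a (global) solution of the problem of minimizing `J` over the set `F`. -/
def IsSolution {Z : Type} (J : Z → ℝ) (F : Set Z) (z : Z) : Prop :=
  z ∈ F ∧ IsMinOn J F z

end SparseControl

end

/-! The argument is the direct method, with compactness supplied by the constraint set. The feasible
set does not depend on `γ`, so one fixed pair competes in every regularized problem. Since
`h_{p,γ}(v) ≤ |v|`, this bounds all states and controls in `L²` (`exists_bound_of_isSolution`). Weak
limits of controls stay in `U_ad` (`Uad_of_weakTendsto`) and weak limits of states solve the limit
equation (`exists_isWeakSolution_limit`).

The difficulty is the nonconvex term `Υ_p`, which is not weakly continuous on `L²`. On `U_ad` it is: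
`Δu = (u - v)/ε` is bounded in `L²`, so cut-offs of `u_k - u₀` tend to zero strongly by a Rellich
argument on the Fourier side (`tendsto_integral_cutoff_sq`). Because `1/p < 2`, the `L²` bound
controls what is left near the boundary (`tendsto_Upsilon_zero`), so no boundary regularity is
needed. Replacing `Υ_p` by `Υ_{p,γ}` costs at most `|Ω| γ^(-1/p)`, uniformly in the control.

Comparing the minimizers with their own weak limit then gives `limsup ‖u_k‖² ≤ ‖u₀‖²`, hence strong
convergence (`tendsto_control_of_weakTendsto`). States are only known to converge weakly and the
state equation may have several solutions, so limits are taken along ultrafilters, with an affine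
minorant replacing the tracking term. Different ultrafilters may give different limit states, but
all resulting pairs are optimal and share one cost. -/

noncomputable section

namespace SparseControl

open scoped FourierTransform SchwartzMap

/-! ### Plancherel's theorem for Fourier integrals -/

section Plancherel

variable {E : Type*} [NormedAddCommGroup E] [InnerProductSpace ℝ E] [FiniteDimensional ℝ E]
  [MeasurableSpace E] [BorelSpace E]

theorem continuous_fourier {f : E → ℂ} (hf : Integrable f) : Continuous (𝓕 f) :=
  VectorFourier.fourierIntegral_continuous Real.continuous_fourierChar
    (L := innerₗ E) (by exact continuous_inner) hf

/-- A locally integrable function that acts on Schwartz functions as the distributional Fourier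
transform of an integrable function `f` is the Fourier integral of `f`. -/
theorem ae_eq_fourier_of_forall_schwartz {f F : E → ℂ} (hf : Integrable f)
    (hF : LocallyIntegrable F) (h : ∀ G : 𝓢(E, ℂ), ∫ x, G x • F x = ∫ x, (𝓕 G) x • f x) :
    F =ᵐ[volume] 𝓕 f := by
  refine ae_eq_of_integral_contDiff_smul_eq hF (continuous_fourier hf).locallyIntegrable ?_
  intro g hg hgc
  have hg' : ContDiff ℝ ∞ (fun x => (g x : ℂ)) := Complex.ofRealCLM.contDiff.comp hg
  have hgc' : HasCompactSupport (fun x => (g x : ℂ)) :=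
    hgc.comp_left (g := fun r : ℝ => (r : ℂ)) Complex.ofReal_zero
  have h1 := h (hgc'.toSchwartzMap hg')
  -- The multiplication formula moves the transform from the test function to `f`; smooth compactly
  -- supported tests then determine `F` almost everywhere.
  have h4 := VectorFourier.integral_fourierIntegral_smul_eq_flip (L := innerₗ E)
    (μ := volume) (ν := volume) Real.continuous_fourierChar (by exact continuous_inner)
    (hgc'.toSchwartzMap hg').integrable hf
  rw [SchwartzMap.fourier_coe] at h1
  have h5 := h1.trans h4
  rw [flip_innerₗ] at h5
  have h6 : ∀ (Ψ : E → ℂ) x, (hgc'.toSchwartzMap hg') x • Ψ x = g x • Ψ x := fun Ψ x =>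
    Complex.coe_smul (g x) (Ψ x)
  simp only [h6] at h5
  exact h5

/-- On integrable square-integrable functions the Fourier integral is the `L²` Fourier transform. -/
theorem exists_Lp_ae_eq_fourier {f : E → ℂ} (hf : Integrable f) (hf2 : MemLp f 2) :
    ∃ Φ : Lp (α := E) ℂ 2, ‖Φ‖ = ‖hf2.toLp f‖ ∧ Φ =ᵐ[volume] 𝓕 f := by
  refine ⟨𝓕 (hf2.toLp f), Lp.norm_fourier_eq _, ?_⟩
  refine ae_eq_fourier_of_forall_schwartz hf
    ((Lp.memLp _).locallyIntegrable (by norm_num)) fun G => ?_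
  have h1 := DFunLike.congr_fun (Lp.fourier_toTemperedDistribution_eq (hf2.toLp f)) G
  rw [TemperedDistribution.fourier_apply, Lp.toTemperedDistribution_apply,
    Lp.toTemperedDistribution_apply] at h1
  rw [← h1]
  refine integral_congr_ae ?_
  filter_upwards [hf2.coeFn_toLp] with x hx
  rw [hx]

/-- Plancherel's theorem for the Fourier integral. -/
theorem fourier_plancherel {f : E → ℂ} (hf : Integrable f) (hf2 : MemLp f 2) :
    Integrable (fun ξ => ‖𝓕 f ξ‖ ^ 2) ∧ ∫ ξ, ‖𝓕 f ξ‖ ^ 2 = ∫ x, ‖f x‖ ^ 2 := by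
  obtain ⟨Φ, hΦ, h⟩ := exists_Lp_ae_eq_fourier hf hf2
  have hm : MemLp (𝓕 f) 2 volume := MemLp.ae_eq h (Lp.memLp _)
  refine ⟨(memLp_two_iff_integrable_sq_norm (f := 𝓕 f) (μ := volume) hm.1).1 hm, ?_⟩
  have key : ∀ g : Lp (α := E) ℂ 2, ‖g‖ ^ 2 = ∫ x, ‖g x‖ ^ 2 := by
    intro g
    have h5 := L2.inner_def (𝕜 := ℂ) g g
    rw [inner_self_eq_norm_sq_to_K] at h5
    have h6 : (∫ x, inner ℂ (g x) (g x) ∂volume) = ((∫ x, ‖g x‖ ^ 2 : ℝ) : ℂ) := by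
      rw [← integral_complex_ofReal]
      refine integral_congr_ae (Eventually.of_forall fun x => ?_)
      simp only [inner_self_eq_norm_sq_to_K]
      simp
    rw [h6] at h5
    exact Complex.ofReal_injective (by simpa using h5)
  have h7 := key Φ
  rw [hΦ, key] at h7
  have h8 : ∫ x, ‖(hf2.toLp f) x‖ ^ 2 = ∫ x, ‖f x‖ ^ 2 := by
    refine integral_congr_ae ?_
    filter_upwards [hf2.coeFn_toLp] with x hx
    rw [hx]
  have h9 : ∫ x, ‖Φ x‖ ^ 2 = ∫ x, ‖𝓕 f x‖ ^ 2 := by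
    refine integral_congr_ae ?_
    filter_upwards [h] with x hx
    rw [hx]
  rw [← h8, h7, h9]

end Plancherel

/-! ### Weak convergence in Hilbert space -/

section Weak

variable {H : Type*} [NormedAddCommGroup H] [InnerProductSpace ℝ H]

/-- Weak convergence in a real Hilbert space along a filter. -/
def WeakTendsto {ι : Type*} (x : ι → H) (l : Filter ι) (x₀ : H) : Prop :=
  ∀ w, Tendsto (fun k => inner ℝ (x k) w) l (𝓝 (inner ℝ x₀ w))

namespace WeakTendsto

variable {ι : Type*} {x z : ι → H} {l : Filter ι} {x₀ z₀ : H}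

theorem of_tendsto (h : Tendsto x l (𝓝 x₀)) : WeakTendsto x l x₀ :=
  fun _ => h.inner tendsto_const_nhds

theorem mono {l' : Filter ι} (h : WeakTendsto x l x₀) (hl : l' ≤ l) : WeakTendsto x l' x₀ :=
  fun w => (h w).mono_left hl

theorem add (hx : WeakTendsto x l x₀) (hz : WeakTendsto z l z₀) :
    WeakTendsto (fun k => x k + z k) l (x₀ + z₀) := fun w => by
  simpa only [inner_add_left] using (hx w).add (hz w)

theorem sub (hx : WeakTendsto x l x₀) (hz : WeakTendsto z l z₀) :
    WeakTendsto (fun k => x k - z k) l (x₀ - z₀) := fun w => by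
  simpa only [inner_sub_left] using (hx w).sub (hz w)

theorem const (c : H) : WeakTendsto (fun _ : ι => c) l c := fun _ => tendsto_const_nhds

/-- In `‖x k - x₀‖² = ‖x k‖² - 2⟨x k, x₀⟩ + ‖x₀‖²` the middle term converges by weak convergence, so
an upper bound on the norms suffices. Tolerance `δ²/4` in both ingredients leaves `3δ²/4 < δ²`. -/
theorem tendsto_of_norm_sq_le (hx : WeakTendsto x l x₀)
    (h : ∀ δ > 0, ∀ᶠ k in l, ‖x k‖ ^ 2 ≤ ‖x₀‖ ^ 2 + δ) : Tendsto x l (𝓝 x₀) := by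
  rw [tendsto_iff_norm_sub_tendsto_zero, Metric.tendsto_nhds]
  intro δ hδ
  have h1 := hx x₀
  rw [real_inner_self_eq_norm_sq] at h1
  have h2 := h1.eventually (lt_mem_nhds (show ‖x₀‖ ^ 2 - δ ^ 2 / 4 < ‖x₀‖ ^ 2 by
    have := pow_pos hδ 2; linarith))
  filter_upwards [h2, h (δ ^ 2 / 4) (by positivity)] with k hk1 hk2
  rw [dist_zero_right, norm_norm]
  have := norm_sub_sq_real (x k) x₀
  refine lt_of_pow_lt_pow_left₀ 2 hδ.le ?_
  nlinarith [pow_pos hδ 2]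

end WeakTendsto

/-- Bounded families have weak limits along ultrafilters. -/
theorem exists_weakTendsto_ultrafilter [CompleteSpace H] {ι : Type*} (x : ι → H)
    (𝒰 : Ultrafilter ι) {B : ℝ} (hB : ∀ k, ‖x k‖ ≤ B) :
    ∃ x₀, ‖x₀‖ ≤ B ∧ WeakTendsto x 𝒰 x₀ := by
  have hc := WeakDual.isCompact_closedBall (𝕜 := ℝ) (E := H) 0 B
  obtain ⟨F, hF, hlim⟩ := hc.ultrafilter_le_nhds
    (𝒰.map (fun k => StrongDual.toWeakDual (InnerProductSpace.toDual ℝ H (x k)))) (by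
      rw [le_principal_iff]
      refine Eventually.of_forall (f := (𝒰 : Filter ι)) fun k => ?_
      simpa using hB k)
  refine ⟨(InnerProductSpace.toDual ℝ H).symm (WeakDual.toStrongDual F), ?_, fun w => ?_⟩
  · simpa using hF
  · have h1 : Tendsto (fun k => StrongDual.toWeakDual (InnerProductSpace.toDual ℝ H (x k)))
      (𝒰 : Filter ι) (𝓝 F) := hlim
    have h2 := ((WeakDual.eval_continuous w).tendsto F).comp h1
    simpa [Function.comp_def] using h2

/-- Bounded sequences in a separable Hilbert space have weakly convergent subsequences. -/
theorem exists_weakTendsto_subseq [CompleteSpace H] [TopologicalSpace.SeparableSpace H]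
    (x : ℕ → H) {B : ℝ} (hB : ∀ k, ‖x k‖ ≤ B) :
    ∃ x₀, ∃ φ : ℕ → ℕ, StrictMono φ ∧ WeakTendsto (x ∘ φ) atTop x₀ := by
  have hc := WeakDual.isSeqCompact_closedBall ℝ H 0 B
  obtain ⟨F, hF, φ, hφ, hlim⟩ := hc
    (x := fun k => StrongDual.toWeakDual (InnerProductSpace.toDual ℝ H (x k)))
    (fun k => by simpa using hB k)
  refine ⟨(InnerProductSpace.toDual ℝ H).symm (WeakDual.toStrongDual F), φ, hφ, fun w => ?_⟩
  have h2 := ((WeakDual.eval_continuous w).tendsto F).comp hlim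
  simpa [Function.comp_def] using h2

/-- A closed subspace of `H × Hⁿ` is weakly sequentially closed. -/
theorem mem_of_weakTendsto [CompleteSpace H] {n : ℕ} {S : Submodule ℝ (H × (Fin n → H))}
    (hS : IsClosed (S : Set (H × (Fin n → H)))) {ι : Type*} {l : Filter ι} [l.NeBot]
    {x : ι → H} {g : ι → Fin n → H} {x₀ : H} {g₀ : Fin n → H} (hx : WeakTendsto x l x₀)
    (hg : ∀ i, WeakTendsto (fun k => g k i) l (g₀ i)) (h : ∀ k, (x k, g k) ∈ S) :
    (x₀, g₀) ∈ S := by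
  by_contra hn
  -- Mazur's argument: the separating functional splits, by Riesz in each factor, into finitely many
  -- inner products, and these pass to the weak limit.
  obtain ⟨F, s, hF1, hF2⟩ := geometric_hahn_banach_point_closed S.convex hS hn
  have hrep : ∀ G : H →L[ℝ] ℝ, ∃ w, ∀ y, G y = inner ℝ y w := fun G =>
    ⟨(InnerProductSpace.toDual ℝ H).symm G, fun y => by
      rw [real_inner_comm, InnerProductSpace.toDual_symm_apply]⟩
  obtain ⟨w, hw⟩ := hrep (F.comp (ContinuousLinearMap.inl ℝ H (Fin n → H)))
  choose w' hw' using fun i => hrep ((F.comp (ContinuousLinearMap.inr ℝ H (Fin n → H))).comp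
    (ContinuousLinearMap.single ℝ (fun _ : Fin n => H) i))
  have hdec : ∀ (y : H) (q : Fin n → H), F (y, q) = inner ℝ y w + ∑ i, inner ℝ (q i) (w' i) := by
    intro y q
    have h1 : (y, q) = ContinuousLinearMap.inl ℝ H (Fin n → H) y
        + ContinuousLinearMap.inr ℝ H (Fin n → H)
          (∑ i, ContinuousLinearMap.single ℝ (fun _ : Fin n => H) i (q i)) := by
      ext
      · simp [Prod.fst_sum]
      · simp [Finset.univ_sum_single]
    rw [h1, map_add, map_sum, map_sum]
    simp only [← hw, ← hw']
    rfl
  have hlim : Tendsto (fun k => F (x k, g k)) l (𝓝 (F (x₀, g₀))) := by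
    simp only [hdec]
    exact (hx w).add (tendsto_finsetSum _ fun i _ => hg i (w' i))
  have h0 : s < 0 := by simpa using hF2 0 S.zero_mem
  exact absurd (ge_of_tendsto' hlim fun k => (hF2 _ (h k)).le) (not_le.2 hF1)

end Weak

end SparseControl

/-! ### Calculus of test functions and their `L²` classes -/

namespace SparseControl

open scoped FourierTransform

variable {n : ℕ} {Ω : Set (EuclideanSpace ℝ (Fin n))}

theorem contDiff_fderiv_apply {F : Type*} [NormedAddCommGroup F] [NormedSpace ℝ F]
    {f : EuclideanSpace ℝ (Fin n) → F} (hf : ContDiff ℝ ∞ f) (v : EuclideanSpace ℝ (Fin n)) :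
    ContDiff ℝ ∞ (fun x => fderiv ℝ f x v) :=
  (hf.fderiv_right (m := ∞) (by simp)).clm_apply contDiff_const

theorem laplacian_eq_sum_fderiv {F : Type*} [NormedAddCommGroup F] [NormedSpace ℝ F]
    {f : EuclideanSpace ℝ (Fin n) → F} (hf : ContDiff ℝ ∞ f) (x : EuclideanSpace ℝ (Fin n)) :
    Laplacian.laplacian f x = ∑ i, fderiv ℝ (fun y => fderiv ℝ f y (EuclideanSpace.single i 1)) x
      (EuclideanSpace.single i 1) := by
  rw [InnerProductSpace.laplacian_eq_iteratedFDeriv_orthonormalBasis f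
    (EuclideanSpace.basisFun (Fin n) ℝ)]
  refine Finset.sum_congr rfl fun i _ => ?_
  rw [iteratedFDeriv_two_apply, fderiv_clm_apply
    (((hf.fderiv_right (m := ∞) (by simp)).differentiable (by simp)) x)
    (differentiableAt_const _)]
  simp

theorem contDiff_laplacian {F : Type*} [NormedAddCommGroup F] [NormedSpace ℝ F]
    {f : EuclideanSpace ℝ (Fin n) → F} (hf : ContDiff ℝ ∞ f) :
    ContDiff ℝ ∞ (Laplacian.laplacian f) := by
  rw [funext (laplacian_eq_sum_fderiv hf)]
  exact ContDiff.sum fun i _ => contDiff_fderiv_apply (contDiff_fderiv_apply hf _) _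

theorem tsupport_laplacian_subset {F : Type*} [NormedAddCommGroup F] [NormedSpace ℝ F]
    {f : EuclideanSpace ℝ (Fin n) → F} : tsupport (Laplacian.laplacian f) ⊆ tsupport f := by
  refine closure_minimal (fun x hx => ?_) (isClosed_tsupport f)
  by_contra hn
  refine hx ?_
  have h0 : f =ᶠ[𝓝 x] fun _ => 0 := notMem_tsupport_iff_eventuallyEq.1 hn
  rw [(InnerProductSpace.laplacian_congr_nhds h0).eq_of_nhds]
  simp

namespace IsTest

variable {φ : EuclideanSpace ℝ (Fin n) → ℝ}

theorem continuous (h : IsTest Ω φ) : Continuous φ := h.1.continuous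

theorem pd (h : IsTest Ω φ) (i : Fin n) : IsTest Ω (pd i φ) :=
  ⟨contDiff_fderiv_apply h.1 _, h.2.1.fderiv_apply ℝ _,
    (tsupport_fderiv_apply_subset ℝ _).trans h.2.2⟩

theorem laplacian (h : IsTest Ω φ) : IsTest Ω (Laplacian.laplacian φ) :=
  ⟨contDiff_laplacian h.1, h.2.1.mono' (subset_closure.trans tsupport_laplacian_subset),
    tsupport_laplacian_subset.trans h.2.2⟩

theorem laplacian_eq (h : IsTest Ω φ) (x : EuclideanSpace ℝ (Fin n)) :
    Laplacian.laplacian φ x = ∑ i, SparseControl.pd i (SparseControl.pd i φ) x :=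
  laplacian_eq_sum_fderiv h.1 x

theorem memLp (h : IsTest Ω φ) : MemLp φ 2 (volume.restrict Ω) :=
  (h.continuous.memLp_of_hasCompactSupport h.2.1).restrict Ω

theorem eq_zero (h : IsTest Ω φ) {x : EuclideanSpace ℝ (Fin n)} (hx : x ∉ Ω) : φ x = 0 :=
  image_eq_zero_of_notMem_tsupport fun hn => hx (h.2.2 hn)

theorem exists_bound (h : IsTest Ω φ) : ∃ C, 0 ≤ C ∧ ∀ x, |φ x| ≤ C := by
  obtain ⟨C, hC⟩ := h.continuous.bounded_above_of_compact_support h.2.1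
  exact ⟨C, (norm_nonneg _).trans (hC 0), hC⟩

end IsTest

/-- The `L²` class of a test function. -/
def IsTest.toL2 {φ : EuclideanSpace ℝ (Fin n) → ℝ} (h : IsTest Ω φ) : L2 Ω := h.memLp.toLp φ

theorem IsTest.coeFn_toL2 {φ : EuclideanSpace ℝ (Fin n) → ℝ} (h : IsTest Ω φ) :
    h.toL2 =ᵐ[volume.restrict Ω] φ := h.memLp.coeFn_toLp

theorem inner_toLp (u : L2 Ω) {g : EuclideanSpace ℝ (Fin n) → ℝ}
    (hg : MemLp g 2 (volume.restrict Ω)) : inner ℝ u (hg.toLp g) = ∫ x in Ω, u x * g x := by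
  rw [L2.inner_def]
  refine integral_congr_ae ?_
  filter_upwards [hg.coeFn_toLp] with x hx
  rw [hx]
  simp [mul_comm]

theorem inner_eq_integral (u v : L2 Ω) : inner ℝ u v = ∫ x in Ω, u x * v x := by
  rw [L2.inner_def]
  refine integral_congr_ae (Eventually.of_forall fun x => ?_)
  simp [mul_comm]

theorem norm_sq_eq_integral (u : L2 Ω) : ‖u‖ ^ 2 = ∫ x in Ω, u x ^ 2 := by
  rw [← real_inner_self_eq_norm_sq, inner_eq_integral]
  simp only [sq]

theorem IsTest.inner_toL2 {φ : EuclideanSpace ℝ (Fin n) → ℝ} (h : IsTest Ω φ) (u : L2 Ω) :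
    inner ℝ u h.toL2 = ∫ x in Ω, u x * φ x := inner_toLp u h.memLp

theorem integrable_mul_memLp (u : L2 Ω) {g : EuclideanSpace ℝ (Fin n) → ℝ}
    (hg : MemLp g 2 (volume.restrict Ω)) : Integrable (fun x => u x * g x) (volume.restrict Ω) :=
  (Lp.memLp u).integrable_mul hg

/-! ### Fourier transforms of cut-offs -/

section Cutoff

variable {χ : EuclideanSpace ℝ (Fin n) → ℝ}

theorem indicator_mul_test (u : L2 Ω) (hχ : IsTest Ω χ) :
    Ω.indicator (fun x => u x * χ x) = fun x => u x * χ x := by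
  ext x
  by_cases hx : x ∈ Ω
  · rw [Set.indicator_of_mem hx]
  · rw [Set.indicator_of_notMem hx, hχ.eq_zero hx, mul_zero]

theorem memLp_mul_test (hΩ : MeasurableSet Ω) (u : L2 Ω) (hχ : IsTest Ω χ) :
    MemLp (fun x => u x * χ x) 2 volume := by
  obtain ⟨C, -, hC⟩ := hχ.exists_bound
  have h1 : MemLp (fun x => u x * χ x) 2 (volume.restrict Ω) := by
    exact MemLp.mul' (p := 2) (q := ⊤) (r := 2)
      (memLp_top_of_bound hχ.continuous.aestronglyMeasurable C (Eventually.of_forall hC))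
      (Lp.memLp u)
  rw [← memLp_indicator_iff_restrict hΩ] at h1
  rwa [indicator_mul_test u hχ] at h1

theorem integrable_mul_test (hΩ : MeasurableSet Ω) (u : L2 Ω) (hχ : IsTest Ω χ) :
    Integrable (fun x => u x * χ x) volume := by
  have h1 := integrable_mul_memLp u hχ.memLp
  rw [← IntegrableOn, ← integrable_indicator_iff hΩ] at h1
  rwa [indicator_mul_test u hχ] at h1

/-- The Fourier transform of the cut-off function `u χ`, extended by zero. -/
def cutFourier (u : L2 Ω) (χ : EuclideanSpace ℝ (Fin n) → ℝ) :
    EuclideanSpace ℝ (Fin n) → ℂ :=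
  𝓕 (fun x => ((u x * χ x : ℝ) : ℂ))

/-- The exponent of the character `x ↦ exp (-2πi ⟨x, ξ⟩)`. -/
def charExponent (ξ : EuclideanSpace ℝ (Fin n)) : EuclideanSpace ℝ (Fin n) →L[ℝ] ℂ :=
  (innerSL ℝ ξ).smulRight (-2 * Real.pi * Complex.I)

theorem charExponent_apply (ξ x : EuclideanSpace ℝ (Fin n)) :
    charExponent ξ x = (inner ℝ ξ x : ℝ) * (-2 * Real.pi * Complex.I) := by
  simp [charExponent]

theorem norm_exp_charExponent (ξ x : EuclideanSpace ℝ (Fin n)) :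
    ‖Complex.exp (charExponent ξ x)‖ = 1 := by
  rw [charExponent_apply, Complex.norm_exp]
  simp

theorem cutFourier_eq (u : L2 Ω) (hχ : IsTest Ω χ) (ξ : EuclideanSpace ℝ (Fin n)) :
    cutFourier u χ ξ = ∫ x in Ω, (u x : ℂ) * (χ x * Complex.exp (charExponent ξ x)) := by
  rw [cutFourier, Real.fourier_eq, setIntegral_eq_integral_of_forall_compl_eq_zero]
  · refine integral_congr_ae (Eventually.of_forall fun x => ?_)
    simp only [Circle.smul_def, smul_eq_mul, Real.fourierChar_apply, charExponent_apply]
    rw [real_inner_comm]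
    push_cast
    rw [show 2 * (Real.pi : ℂ) * -(inner ℝ ξ x : ℝ) * Complex.I
      = (inner ℝ ξ x : ℝ) * (-2 * Real.pi * Complex.I) by ring]
    ring
  · intro x hx
    rw [hχ.eq_zero hx]
    simp

theorem cutFourier_plancherel (hΩ : MeasurableSet Ω) (u : L2 Ω) (hχ : IsTest Ω χ) :
    Integrable (fun ξ => ‖cutFourier u χ ξ‖ ^ 2) ∧
      ∫ ξ, ‖cutFourier u χ ξ‖ ^ 2 = ∫ x in Ω, (u x * χ x) ^ 2 := by
  have h := fourier_plancherel (integrable_mul_test hΩ u hχ).ofReal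
    ((memLp_mul_test hΩ u hχ).ofReal (K := ℂ))
  refine ⟨h.1, h.2.trans ?_⟩
  rw [setIntegral_eq_integral_of_forall_compl_eq_zero]
  · refine integral_congr_ae (Eventually.of_forall fun x => ?_)
    simp [sq_abs, mul_pow]
  · intro x hx
    rw [hχ.eq_zero hx]
    simp

theorem integral_mul_sq_le (u : L2 Ω) {C : ℝ} (hC : ∀ x, |χ x| ≤ C) :
    ∫ x in Ω, (u x * χ x) ^ 2 ≤ C ^ 2 * ‖u‖ ^ 2 := by
  rw [norm_sq_eq_integral, ← integral_const_mul]
  refine integral_mono_of_nonneg (Eventually.of_forall fun x => sq_nonneg _)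
    ((Lp.memLp u).integrable_sq.const_mul _) (Eventually.of_forall fun x => ?_)
  have h1 : χ x ^ 2 ≤ C ^ 2 := by
    rw [← sq_abs]; exact pow_le_pow_left₀ (abs_nonneg _) (hC x) 2
  simp only [mul_pow]
  nlinarith [sq_nonneg (u x)]

theorem exists_integral_cutFourier_le (hΩ : MeasurableSet Ω) (hχ : IsTest Ω χ) (B : ℝ) :
    ∃ A, ∀ u : L2 Ω, ‖u‖ ≤ B → ∫ ξ, ‖cutFourier u χ ξ‖ ^ 2 ≤ A := by
  obtain ⟨C, -, hC⟩ := hχ.exists_bound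
  refine ⟨C ^ 2 * B ^ 2, fun u hu => ?_⟩
  rw [(cutFourier_plancherel hΩ u hχ).2]
  refine (integral_mul_sq_le u hC).trans ?_
  gcongr

theorem exists_norm_cutFourier_le (hχ : IsTest Ω χ) (B : ℝ) :
    ∃ A, ∀ u : L2 Ω, ‖u‖ ≤ B → ∀ ξ, ‖cutFourier u χ ξ‖ ≤ A := by
  -- The constant comes from `|uχ| ≤ u² + χ²`; uniformity in `ξ` provides the dominating function on
  -- low frequencies.
  refine ⟨B ^ 2 + ∫ x in Ω, χ x ^ 2, fun u hu ξ => ?_⟩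
  rw [cutFourier_eq u hχ]
  refine (norm_integral_le_integral_norm _).trans ?_
  have h1 : ‖u‖ ^ 2 ≤ B ^ 2 := by gcongr
  rw [norm_sq_eq_integral] at h1
  refine le_trans ?_ (add_le_add_left h1 _)
  rw [← integral_add (Lp.memLp u).integrable_sq hχ.memLp.integrable_sq]
  refine integral_mono_of_nonneg (Eventually.of_forall fun x => norm_nonneg _)
    ((Lp.memLp u).integrable_sq.add hχ.memLp.integrable_sq) (Eventually.of_forall fun x => ?_)
  simp only [norm_mul, norm_exp_charExponent, mul_one, Complex.norm_real, Real.norm_eq_abs]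
  nlinarith [sq_nonneg (|u x| - |χ x|), sq_abs (u x), sq_abs (χ x), sq_nonneg (u x),
    sq_nonneg (χ x)]

theorem memLp_mul_exp (hχ : IsTest Ω χ) (ξ : EuclideanSpace ℝ (Fin n)) :
    MemLp (fun x => (χ x : ℂ) * Complex.exp (charExponent ξ x)) 2 (volume.restrict Ω) := by
  have hc : Continuous fun x => Complex.exp (charExponent ξ x) :=
    Complex.continuous_exp.comp (charExponent ξ).continuous
  refine ((hχ.memLp.ofReal (K := ℂ)).norm).mono
    ((Complex.continuous_ofReal.comp hχ.continuous).mul hc).aestronglyMeasurable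
    (Eventually.of_forall fun x => ?_)
  simp [norm_exp_charExponent]

/-- Fourier transforms of cut-offs of a weakly null sequence converge to zero pointwise. -/
theorem tendsto_cutFourier {ι : Type*} {l : Filter ι} {d : ι → L2 Ω} (hd : WeakTendsto d l 0)
    (hχ : IsTest Ω χ) (ξ : EuclideanSpace ℝ (Fin n)) :
    Tendsto (fun k => cutFourier (d k) χ ξ) l (𝓝 0) := by
  have hg := memLp_mul_exp hχ ξ
  -- For fixed `ξ` the transform is a pair of real inner products with fixed `L²` functions, so weak
  -- convergence applies.
  have key : ∀ k, cutFourier (d k) χ ξ = ((inner ℝ (d k) (hg.re.toLp _) : ℝ) : ℂ)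
      + (inner ℝ (d k) (hg.im.toLp _) : ℝ) * Complex.I := by
    intro k
    rw [cutFourier_eq _ hχ, inner_toLp, inner_toLp, ← integral_complex_ofReal,
      ← integral_complex_ofReal, ← integral_mul_const, ← integral_add]
    · refine integral_congr_ae (Eventually.of_forall fun x => ?_)
      have := Complex.re_add_im ((χ x : ℂ) * Complex.exp (charExponent ξ x))
      simp only [RCLike.re_eq_complex_re, RCLike.im_eq_complex_im, Complex.ofReal_mul]
      conv_lhs => rw [← this]
      ring
    · exact (integrable_mul_memLp _ hg.re).ofReal
    · exact (integrable_mul_memLp _ hg.im).ofReal.mul_const _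
  simp only [key]
  have h1 := hd (hg.re.toLp _)
  have h2 := hd (hg.im.toLp _)
  rw [inner_zero_left] at h1 h2
  have := ((Complex.continuous_ofReal.tendsto 0).comp h1).add
    (((Complex.continuous_ofReal.tendsto 0).comp h2).mul_const Complex.I)
  simpa [Function.comp_def] using this

theorem fderiv_mul_exp {f : EuclideanSpace ℝ (Fin n) → ℂ} (hf : ContDiff ℝ ∞ f)
    (L : EuclideanSpace ℝ (Fin n) →L[ℝ] ℂ) (x v : EuclideanSpace ℝ (Fin n)) :
    fderiv ℝ (fun x => f x * Complex.exp (L x)) x v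
      = (fderiv ℝ f x v + L v * f x) * Complex.exp (L x) := by
  have h1 := ((hf.differentiable (by simp)) x).hasFDerivAt.mul (L.hasFDerivAt (x := x)).cexp
  rw [show (fun x => f x * Complex.exp (L x)) = f * fun x => Complex.exp (L x) from rfl, h1.fderiv]
  simp
  ring

theorem laplacian_mul_exp {f : EuclideanSpace ℝ (Fin n) → ℂ} (hf : ContDiff ℝ ∞ f)
    (L : EuclideanSpace ℝ (Fin n) →L[ℝ] ℂ) (x : EuclideanSpace ℝ (Fin n)) :
    Laplacian.laplacian (fun x => f x * Complex.exp (L x)) x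
      = (Laplacian.laplacian f x
        + 2 * ∑ i, L (EuclideanSpace.single i 1) * fderiv ℝ f x (EuclideanSpace.single i 1)
        + (∑ i, L (EuclideanSpace.single i 1) ^ 2) * f x) * Complex.exp (L x) := by
  have hL : ContDiff ℝ ∞ fun x => Complex.exp (L x) := Complex.contDiff_exp.comp L.contDiff
  rw [laplacian_eq_sum_fderiv (hf.mul hL), laplacian_eq_sum_fderiv hf, Finset.mul_sum,
    Finset.sum_mul, ← Finset.sum_add_distrib, ← Finset.sum_add_distrib, Finset.sum_mul]
  refine Finset.sum_congr rfl fun i _ => ?_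
  set e : EuclideanSpace ℝ (Fin n) := EuclideanSpace.single i 1
  rw [funext fun y => fderiv_mul_exp hf L y e,
    fderiv_mul_exp ((contDiff_fderiv_apply hf e).add (contDiff_const.mul hf)) L x e]
  have h1 := (((contDiff_fderiv_apply hf e).differentiable (by simp)) x).hasFDerivAt.add
    ((((hf.differentiable (by simp)) x).hasFDerivAt).const_mul (L e))
  have h2 : fderiv ℝ (fun y => fderiv ℝ f y e + L e * f y) x e
      = fderiv ℝ (fun y => fderiv ℝ f y e) x e + L e * fderiv ℝ f x e := by
    refine (congrArg (fun T : _ →L[ℝ] ℂ => T e) (HasFDerivAt.fderiv h1)).trans ?_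
    simp
  rw [h2]
  ring

/-- This is the eigenvalue of the Laplacian on the character with frequency `ξ`. -/
theorem sum_charExponent_sq (ξ : EuclideanSpace ℝ (Fin n)) :
    ∑ i, charExponent ξ (EuclideanSpace.single i 1) ^ 2
      = -(((2 * Real.pi * ‖ξ‖) ^ 2 : ℝ) : ℂ) := by
  rw [mul_pow, EuclideanSpace.norm_sq_eq, Finset.mul_sum]
  push_cast
  rw [← Finset.sum_neg_distrib]
  refine Finset.sum_congr rfl fun i _ => ?_
  rw [charExponent_apply]
  simp only [EuclideanSpace.inner_single_right, one_mul, Real.norm_eq_abs]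
  rw [← Complex.ofReal_pow |ξ i|, sq_abs]
  simp only [conj_trivial]
  push_cast
  ring_nf
  rw [Complex.I_sq]
  ring

/-- A distributional identity tested with complex-valued test functions. -/
theorem integral_laplacian_complex {d F : L2 Ω}
    (h : ∀ φ, IsTest Ω φ → ∫ x in Ω, d x * Laplacian.laplacian φ x = ∫ x in Ω, F x * φ x)
    {ψ : EuclideanSpace ℝ (Fin n) → ℂ} (hψ : ContDiff ℝ ∞ ψ) (hc : HasCompactSupport ψ)
    (hs : tsupport ψ ⊆ Ω) :
    ∫ x in Ω, (d x : ℂ) * Laplacian.laplacian ψ x = ∫ x in Ω, (F x : ℂ) * ψ x := by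
  have htest : ∀ l : ℂ →L[ℝ] ℝ, IsTest Ω (l ∘ ψ) := fun l =>
    ⟨l.contDiff.comp hψ, hc.comp_left (map_zero l),
      (closure_mono (Function.support_comp_subset (map_zero l) ψ)).trans hs⟩
  have hint : ∀ (u : L2 Ω) {g : EuclideanSpace ℝ (Fin n) → ℂ}, Continuous g →
      HasCompactSupport g → Integrable (fun x => (u x : ℂ) * g x) (volume.restrict Ω) := by
    intro u g hg hgc
    exact (((Lp.memLp u).ofReal (K := ℂ))).integrable_mul
      ((hg.memLp_of_hasCompactSupport (p := 2) (μ := volume) hgc).restrict Ω)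
  have hlc : HasCompactSupport (Laplacian.laplacian ψ) :=
    hc.mono' (subset_closure.trans tsupport_laplacian_subset)
  have i1 := hint d (contDiff_laplacian hψ).continuous hlc
  have i2 := hint F hψ.continuous hc
  have key : ∀ l : ℂ →L[ℝ] ℝ, (∀ (r : ℝ) (z : ℂ), l (r * z) = r * l z) →
      l (∫ x in Ω, (d x : ℂ) * Laplacian.laplacian ψ x) = l (∫ x in Ω, (F x : ℂ) * ψ x) := by
    intro l hl
    rw [← l.integral_comp_comm i1, ← l.integral_comp_comm i2]
    have := h _ (htest l)
    simp only [hl]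
    rw [show (Laplacian.laplacian (l ∘ ψ)) = fun x => l (Laplacian.laplacian ψ x) from
      funext fun x => ContDiffAt.laplacian_CLM_comp_left
        (contDiff_infty.1 hψ 2).contDiffAt] at this
    exact this
  exact Complex.ext (key Complex.reCLM fun r z => by simp)
    (key Complex.imCLM fun r z => by simp)

end Cutoff

end SparseControl

namespace SparseControl

open scoped FourierTransform

/-! ### Local compactness from bounded Laplacians -/

section Cutoff

variable {n : ℕ} {Ω : Set (EuclideanSpace ℝ (Fin n))} {χ : EuclideanSpace ℝ (Fin n) → ℝ}

/-- If `Δd = F` in the sense of distributions, this is the Fourier transform of the identity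
`Δ(χd) = χF + 2 div (d∇χ) - dΔχ`. -/
theorem cutFourier_identity {d F : L2 Ω}
    (h : ∀ φ, IsTest Ω φ → ∫ x in Ω, d x * Laplacian.laplacian φ x = ∫ x in Ω, F x * φ x)
    (hχ : IsTest Ω χ) (ξ : EuclideanSpace ℝ (Fin n)) :
    (((2 * Real.pi * ‖ξ‖) ^ 2 : ℝ) : ℂ) * cutFourier d χ ξ
      = cutFourier d (Laplacian.laplacian χ) ξ
        + 2 * ∑ i, charExponent ξ (EuclideanSpace.single i 1) * cutFourier d (pd i χ) ξ
        - cutFourier F χ ξ := by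
  have hf : ContDiff ℝ ∞ (fun x => (χ x : ℂ)) := Complex.ofRealCLM.contDiff.comp hχ.1
  have he : ContDiff ℝ ∞ fun x => Complex.exp (charExponent ξ x) :=
    Complex.contDiff_exp.comp (charExponent ξ).contDiff
  have hsub : Function.support (fun x => (χ x : ℂ) * Complex.exp (charExponent ξ x))
      ⊆ tsupport χ := by
    intro x hx
    refine subset_tsupport _ fun h0 => hx ?_
    simp [h0]
  -- The test function is `χ` times the character. The product rule yields `Δχ`, the mixed
  -- first-order terms and the eigenvalue term.
  have h1 := integral_laplacian_complex h (hf.mul he) (hχ.2.1.mono' hsub)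
    ((closure_minimal hsub (isClosed_tsupport χ)).trans hχ.2.2)
  rw [← cutFourier_eq F hχ] at h1
  have hint : ∀ {ψ : EuclideanSpace ℝ (Fin n) → ℝ}, IsTest Ω ψ → Integrable
      (fun x => (d x : ℂ) * (ψ x * Complex.exp (charExponent ξ x))) (volume.restrict Ω) :=
    fun hψ => ((Lp.memLp d).ofReal (K := ℂ)).integrable_mul (memLp_mul_exp hψ ξ)
  have hfd : ∀ x v, fderiv ℝ (fun x => (χ x : ℂ)) x v = ((fderiv ℝ χ x v : ℝ) : ℂ) := by
    intro x v
    have h2 := Complex.ofRealCLM.hasFDerivAt.comp x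
      ((hχ.1.differentiable (by simp)) x).hasFDerivAt
    exact congrArg (fun T : _ →L[ℝ] ℂ => T v) h2.fderiv
  have hlap : ∀ x, Laplacian.laplacian (fun x => (χ x : ℂ)) x
      = ((Laplacian.laplacian χ x : ℝ) : ℂ) := fun x =>
    ContDiffAt.laplacian_CLM_comp_left (l := Complex.ofRealCLM)
      (contDiff_infty.1 hχ.1 2).contDiffAt
  have h3 : ∀ x, (d x : ℂ) * Laplacian.laplacian
        (fun x => (χ x : ℂ) * Complex.exp (charExponent ξ x)) x
      = (d x : ℂ) * (Laplacian.laplacian χ x * Complex.exp (charExponent ξ x))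
        + (2 * ∑ i, charExponent ξ (EuclideanSpace.single i 1) *
            ((d x : ℂ) * (pd i χ x * Complex.exp (charExponent ξ x)))
          + -(((2 * Real.pi * ‖ξ‖) ^ 2 : ℝ) : ℂ)
            * ((d x : ℂ) * (χ x * Complex.exp (charExponent ξ x)))) := by
    intro x
    rw [laplacian_mul_exp hf, sum_charExponent_sq, hlap]
    simp only [hfd]
    rw [show (∑ i, charExponent ξ (EuclideanSpace.single i 1) *
            ((d x : ℂ) * (pd i χ x * Complex.exp (charExponent ξ x))))
        = (d x : ℂ) * (∑ i, charExponent ξ (EuclideanSpace.single i 1) * (pd i χ x : ℂ))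
          * Complex.exp (charExponent ξ x) by
      rw [Finset.mul_sum, Finset.sum_mul]
      exact Finset.sum_congr rfl fun i _ => by ring]
    simp only [pd]
    ring
  have hs : Integrable (fun x => 2 * ∑ i, charExponent ξ (EuclideanSpace.single i 1) *
      ((d x : ℂ) * (pd i χ x * Complex.exp (charExponent ξ x)))) (volume.restrict Ω) :=
    (integrable_finsetSum _ fun i _ => (hint (hχ.pd i)).const_mul _).const_mul _
  simp only [h3] at h1
  rw [integral_add (hint hχ.laplacian) (hs.fun_add ((hint hχ).const_mul _)),
    integral_add hs ((hint hχ).const_mul _), integral_const_mul, integral_const_mul,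
    integral_finsetSum _ (fun i _ => (hint (hχ.pd i)).const_mul _)] at h1
  simp only [integral_const_mul] at h1
  rw [← cutFourier_eq d hχ.laplacian, ← cutFourier_eq d hχ] at h1
  simp only [← cutFourier_eq d (hχ.pd _)] at h1
  linear_combination -h1

/-- High-frequency bound for cut-offs of functions with square integrable Laplacian. -/
theorem norm_cutFourier_sq_le {d F : L2 Ω}
    (h : ∀ φ, IsTest Ω φ → ∫ x in Ω, d x * Laplacian.laplacian φ x = ∫ x in Ω, F x * φ x)
    (hχ : IsTest Ω χ) {R : ℝ} (hR : 1 ≤ R) {ξ : EuclideanSpace ℝ (Fin n)} (hξ : R ≤ ‖ξ‖) :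
    R ^ 2 * ‖cutFourier d χ ξ‖ ^ 2
      ≤ 3 * (‖cutFourier d (Laplacian.laplacian χ) ξ‖ ^ 2
        + n * ∑ i, ‖cutFourier d (pd i χ) ξ‖ ^ 2 + ‖cutFourier F χ ξ‖ ^ 2) := by
  set a := ‖cutFourier d (Laplacian.laplacian χ) ξ‖
  set b : Fin n → ℝ := fun i => ‖cutFourier d (pd i χ) ξ‖ with hb
  set c := ‖cutFourier F χ ξ‖
  set t := ‖cutFourier d χ ξ‖
  have hpi := Real.pi_gt_three
  have hL : ∀ i, ‖charExponent ξ (EuclideanSpace.single i 1)‖ ≤ 2 * Real.pi * ‖ξ‖ := by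
    intro i
    rw [charExponent_apply, norm_mul, mul_comm]
    have h1 : ‖((inner ℝ ξ (EuclideanSpace.single i 1) : ℝ) : ℂ)‖ ≤ ‖ξ‖ := by
      rw [Complex.norm_real]
      refine (norm_inner_le_norm _ _).trans ?_
      simp
    have h2 : ‖(-2 * Real.pi * Complex.I : ℂ)‖ = 2 * Real.pi := by
      simp [abs_of_pos Real.pi_pos]
    rw [h2]
    gcongr
  have h1 : (2 * Real.pi * ‖ξ‖) ^ 2 * t ≤ a + 2 * ∑ i, 2 * Real.pi * ‖ξ‖ * b i + c := by
    have h2 := congrArg norm (cutFourier_identity h hχ ξ)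
    rw [norm_mul, Complex.norm_real, Real.norm_of_nonneg (by positivity)] at h2
    rw [h2]
    refine (norm_sub_le _ _).trans (add_le_add_left ((norm_add_le _ _).trans
      (add_le_add_right ?_ _)) _)
    rw [norm_mul, Complex.norm_ofNat]
    gcongr
    refine (norm_sum_le _ _).trans (Finset.sum_le_sum fun i _ => ?_)
    rw [norm_mul]
    exact mul_le_mul_of_nonneg_right (hL i) (norm_nonneg _)
  rw [← Finset.mul_sum] at h1
  have hS : (∑ i, b i) ^ 2 ≤ n * ∑ i, b i ^ 2 := by
    simpa using sq_sum_le_card_mul_sum_sq (s := Finset.univ) (f := b)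
  set S := ∑ i, b i
  have hS0 : 0 ≤ S := Finset.sum_nonneg fun i _ => norm_nonneg _
  have ha : 0 ≤ a := norm_nonneg _
  have hc : 0 ≤ c := norm_nonneg _
  have ht : 0 ≤ t := norm_nonneg _
  -- With `q = 2π‖ξ‖ ≥ 2R`, the bound `q² t ≤ a + 2qS + c` gives `qRt ≤ q² t / 2 ≤ a/2 + qS + c/2`;
  -- since `q ≥ 2`, one factor `q` can be cancelled.
  have h3 : R * t ≤ a + S + c := by
    set q := 2 * Real.pi * ‖ξ‖ with hq
    have hqR : 2 * R ≤ q := by nlinarith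
    have hq1 : 2 ≤ q := by linarith
    have h4 : q * (R * t) ≤ q * (a + S + c) := by nlinarith [mul_nonneg ht (by linarith : 0 ≤ q)]
    exact le_of_mul_le_mul_left h4 (by linarith)
  have h5 : (R * t) ^ 2 ≤ (a + S + c) ^ 2 := pow_le_pow_left₀ (by positivity) h3 2
  have h6 : (a + S + c) ^ 2 ≤ 3 * (a ^ 2 + S ^ 2 + c ^ 2) := by
    nlinarith [sq_nonneg (a - S), sq_nonneg (a - c), sq_nonneg (S - c)]
  rw [← mul_pow]
  linarith

/-- Local compactness: bounded sequences that converge weakly to zero and have bounded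
distributional Laplacians converge to zero strongly in `L²` after multiplication by a cut-off. -/
theorem tendsto_integral_cutoff_sq (hΩ : MeasurableSet Ω) {d F : ℕ → L2 Ω} {B : ℝ}
    (hd : ∀ k, ‖d k‖ ≤ B) (hF : ∀ k, ‖F k‖ ≤ B) (hw : WeakTendsto d atTop 0)
    (h : ∀ k φ, IsTest Ω φ →
      ∫ x in Ω, d k x * Laplacian.laplacian φ x = ∫ x in Ω, F k x * φ x)
    (hχ : IsTest Ω χ) :
    Tendsto (fun k => ∫ x in Ω, (d k x * χ x) ^ 2) atTop (𝓝 0) := by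
  simp only [← (cutFourier_plancherel hΩ _ hχ).2]
  obtain ⟨A₁, hA₁⟩ := exists_integral_cutFourier_le hΩ hχ.laplacian B
  choose A₂ hA₂ using fun i => exists_integral_cutFourier_le hΩ (hχ.pd i) B
  obtain ⟨A₃, hA₃⟩ := exists_integral_cutFourier_le hΩ hχ B
  obtain ⟨A₄, hA₄⟩ := exists_norm_cutFourier_le hχ B
  set A := 3 * (A₁ + n * ∑ i, A₂ i + A₃) with hA
  have hG : ∀ k, Integrable (fun ξ => 3 * (‖cutFourier (d k) (Laplacian.laplacian χ) ξ‖ ^ 2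
        + n * ∑ i, ‖cutFourier (d k) (pd i χ) ξ‖ ^ 2 + ‖cutFourier (F k) χ ξ‖ ^ 2)) := fun k =>
    (((cutFourier_plancherel hΩ _ hχ.laplacian).1.add ((integrable_finsetSum _ fun i _ =>
      (cutFourier_plancherel hΩ _ (hχ.pd i)).1).const_mul _)).add
        (cutFourier_plancherel hΩ _ hχ).1).const_mul _
  have hGA : ∀ k, ∫ ξ, 3 * (‖cutFourier (d k) (Laplacian.laplacian χ) ξ‖ ^ 2
        + n * ∑ i, ‖cutFourier (d k) (pd i χ) ξ‖ ^ 2 + ‖cutFourier (F k) χ ξ‖ ^ 2) ≤ A := by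
    intro k
    have i1 := (cutFourier_plancherel hΩ (d k) hχ.laplacian).1
    have i2 := fun i => (cutFourier_plancherel hΩ (d k) (hχ.pd i)).1
    have i3 := (cutFourier_plancherel hΩ (F k) hχ).1
    have i4 := (integrable_finsetSum Finset.univ fun i _ => i2 i).const_mul (n : ℝ)
    rw [integral_const_mul, integral_add (i1.fun_add i4) i3, integral_add i1 i4, integral_const_mul,
      integral_finsetSum _ fun i _ => i2 i, hA]
    have j1 := hA₁ (d k) (hd k)
    have j2 := Finset.sum_le_sum fun i (_ : i ∈ Finset.univ) => hA₂ i (d k) (hd k)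
    have j3 := hA₃ (F k) (hF k)
    gcongr
  have hA0 : 0 ≤ A := (integral_nonneg fun ξ => by positivity).trans (hGA 0)
  rw [Metric.tendsto_nhds]
  intro δ hδ
  obtain ⟨R, hR1, hR2⟩ : ∃ R : ℝ, 1 ≤ R ∧ A / R ^ 2 < δ / 2 := by
    refine ⟨1 + 2 * A / δ, by have := div_nonneg (mul_nonneg zero_le_two hA0) hδ.le; linarith, ?_⟩
    have h1 : 0 ≤ A / δ := div_nonneg hA0 hδ.le
    rw [div_lt_iff₀ (by positivity), mul_div_assoc]
    have h2 : A = A / δ * δ := by field_simp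
    set r := A / δ
    rw [h2]
    nlinarith [mul_nonneg h1 hδ.le, mul_nonneg (mul_nonneg h1 h1) hδ.le]
  -- Low frequencies vanish by dominated convergence on a ball; high frequencies are at most `A /
  -- R²` uniformly in `k`.
  have hlow : Tendsto (fun k => ∫ ξ in Metric.ball 0 R, ‖cutFourier (d k) χ ξ‖ ^ 2) atTop
      (𝓝 0) := by
    have h1 : Tendsto (fun k => ∫ ξ in Metric.ball 0 R, ‖cutFourier (d k) χ ξ‖ ^ 2) atTop
        (𝓝 (∫ _ in Metric.ball (0 : EuclideanSpace ℝ (Fin n)) R, (0 : ℝ))) := by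
      refine tendsto_integral_of_dominated_convergence (fun _ => A₄ ^ 2) (fun k =>
        (cutFourier_plancherel hΩ _ hχ).1.aestronglyMeasurable.restrict)
        (integrable_const_iff.2 (Or.inr ⟨by simpa using measure_ball_lt_top⟩))
        (fun k => Eventually.of_forall fun ξ => ?_) (Eventually.of_forall fun ξ => ?_)
      · rw [norm_pow, norm_norm]
        exact pow_le_pow_left₀ (norm_nonneg _) (hA₄ (d k) (hd k) ξ) 2
      · simpa using ((tendsto_cutFourier hw hχ ξ).norm).pow 2
    simpa using h1
  filter_upwards [hlow.eventually (gt_mem_nhds (half_pos hδ))] with k hk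
  have hi := (cutFourier_plancherel hΩ (d k) hχ).1
  rw [dist_zero_right, Real.norm_of_nonneg (integral_nonneg fun ξ => by positivity),
    ← integral_add_compl (measurableSet_ball (x := (0 : EuclideanSpace ℝ (Fin n))) (ε := R)) hi]
  have hhigh : ∫ ξ in (Metric.ball (0 : EuclideanSpace ℝ (Fin n)) R)ᶜ, ‖cutFourier (d k) χ ξ‖ ^ 2
      ≤ A / R ^ 2 := by
    rw [le_div_iff₀ (by positivity), mul_comm, ← integral_const_mul]
    refine (setIntegral_mono_on (hi.const_mul _).integrableOn (hG k).integrableOn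
      measurableSet_ball.compl fun ξ hξ => ?_).trans
      ((setIntegral_le_integral (hG k) (Eventually.of_forall fun ξ => by positivity)).trans (hGA k))
    exact norm_cutFourier_sq_le (h k) hχ hR1 (by simpa using hξ)
  linarith

end Cutoff

end SparseControl

namespace SparseControl

/-! ### The space `H¹₀` and weak closedness of `U_ad` -/

section Sobolev

variable {n : ℕ} {Ω : Set (EuclideanSpace ℝ (Fin n))}

theorem IsTest.add {φ ψ : EuclideanSpace ℝ (Fin n) → ℝ} (hφ : IsTest Ω φ) (hψ : IsTest Ω ψ) :
    IsTest Ω (φ + ψ) :=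
  ⟨hφ.1.add hψ.1, hφ.2.1.add hψ.2.1, (tsupport_add φ ψ).trans (Set.union_subset hφ.2.2 hψ.2.2)⟩

theorem IsTest.const_smul {φ : EuclideanSpace ℝ (Fin n) → ℝ} (hφ : IsTest Ω φ) (c : ℝ) :
    IsTest Ω (c • φ) :=
  ⟨hφ.1.const_smul c, hφ.2.1.smul_left (f := fun _ => c),
    (closure_mono (Function.support_const_smul_subset c φ)).trans hφ.2.2⟩

theorem isTest_zero : IsTest Ω (0 : EuclideanSpace ℝ (Fin n) → ℝ) :=
  ⟨contDiff_const, HasCompactSupport.zero, by simp [tsupport]⟩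

/-- The pairs `(φ, ∇φ)` with `φ` a test function. -/
def testGraph (Ω : Set (EuclideanSpace ℝ (Fin n))) : Submodule ℝ (L2 Ω × (Fin n → L2 Ω)) where
  carrier := {z | ∃ φ, IsTest Ω φ ∧ z.1 =ᵐ[volume.restrict Ω] φ ∧
    ∀ i, z.2 i =ᵐ[volume.restrict Ω] pd i φ}
  zero_mem' := ⟨0, isTest_zero, Lp.coeFn_zero _ _ _, fun i => by
    have h0 : pd i (0 : EuclideanSpace ℝ (Fin n) → ℝ) = 0 := by
      ext x
      simp [pd]
    rw [h0]
    exact Lp.coeFn_zero _ _ _⟩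
  add_mem' := by
    rintro z w ⟨φ, hφ, h1, h2⟩ ⟨ψ, hψ, h3, h4⟩
    refine ⟨φ + ψ, hφ.add hψ, (Lp.coeFn_add _ _).trans (h1.add h3), fun i => ?_⟩
    have h0 : pd i (φ + ψ) = pd i φ + pd i ψ := by
      ext x
      simp [pd, fderiv_add ((hφ.1.differentiable (by simp)) x)
        ((hψ.1.differentiable (by simp)) x)]
    rw [h0]
    exact (Lp.coeFn_add _ _).trans ((h2 i).add (h4 i))
  smul_mem' := by
    rintro c z ⟨φ, hφ, h1, h2⟩
    refine ⟨c • φ, hφ.const_smul c, (Lp.coeFn_smul _ _).trans (h1.const_smul c), fun i => ?_⟩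
    have h0 : pd i (c • φ) = c • pd i φ := by
      ext x
      simp [pd, fderiv_const_smul ((hφ.1.differentiable (by simp)) x)]
    rw [h0]
    exact (Lp.coeFn_smul _ _).trans ((h2 i).const_smul c)

theorem coe_topologicalClosure_testGraph :
    ((testGraph Ω).topologicalClosure : Set (L2 Ω × (Fin n → L2 Ω))) = H10Graph Ω :=
  (testGraph Ω).topologicalClosure_coe

theorem H10Graph_of_weakTendsto {ι : Type*} {l : Filter ι} [l.NeBot]
    {x : ι → L2 Ω} {g : ι → Fin n → L2 Ω} {x₀ : L2 Ω} {g₀ : Fin n → L2 Ω}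
    (hx : WeakTendsto x l x₀) (hg : ∀ i, WeakTendsto (fun k => g k i) l (g₀ i))
    (h : ∀ k, (x k, g k) ∈ H10Graph Ω) : (x₀, g₀) ∈ H10Graph Ω := by
  rw [← coe_topologicalClosure_testGraph]
  refine mem_of_weakTendsto (testGraph Ω).isClosed_topologicalClosure hx hg fun k => ?_
  rw [← SetLike.mem_coe, coe_topologicalClosure_testGraph]
  exact h k

/-- A closed property of pairs `(v, ∇v)` holds on `H¹₀` if it holds for test functions. -/
theorem H10Graph_induction {P : L2 Ω × (Fin n → L2 Ω) → Prop} (hP : IsClosed {z | P z})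
    (h : ∀ φ (hφ : IsTest Ω φ), P (hφ.toL2, fun i => (hφ.pd i).toL2))
    {z : L2 Ω × (Fin n → L2 Ω)} (hz : z ∈ H10Graph Ω) : P z := by
  refine closure_minimal ?_ hP hz
  rintro ⟨v, q⟩ ⟨φ, hφ, h1, h2⟩
  have e1 : v = hφ.toL2 := Lp.ext (h1.trans hφ.coeFn_toL2.symm)
  have e2 : q = fun i => (hφ.pd i).toL2 :=
    funext fun i => Lp.ext ((h2 i).trans (hφ.pd i).coeFn_toL2.symm)
  rw [e1, e2]
  exact h φ hφ

theorem inner_toL2_toL2 {φ ψ : EuclideanSpace ℝ (Fin n) → ℝ} (hφ : IsTest Ω φ)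
    (hψ : IsTest Ω ψ) : inner ℝ hφ.toL2 hψ.toL2 = ∫ x, φ x * ψ x := by
  have h0 : ∫ x in Ω, φ x * ψ x = ∫ x, φ x * ψ x :=
    setIntegral_eq_integral_of_forall_compl_eq_zero fun x hx => by rw [hφ.eq_zero hx, zero_mul]
  rw [hψ.inner_toL2, ← h0]
  refine integral_congr_ae ?_
  filter_upwards [hφ.coeFn_toL2] with x hx
  rw [hx]

theorem integral_mul_pd {φ ψ : EuclideanSpace ℝ (Fin n) → ℝ} (hφ : IsTest Ω φ)
    (hψ : IsTest Ω ψ) (i : Fin n) : ∫ x, φ x * pd i ψ x = -∫ x, pd i φ x * ψ x := by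
  have hint : ∀ {f g : EuclideanSpace ℝ (Fin n) → ℝ}, IsTest Ω f → IsTest Ω g →
      Integrable (fun x => f x * g x) volume := fun hf hg =>
    (hf.continuous.mul hg.continuous).integrable_of_hasCompactSupport hf.2.1.mul_right
  exact integral_mul_fderiv_eq_neg_fderiv_mul_of_integrable (hint (hφ.pd i) hψ)
    (hint hφ (hψ.pd i)) (hint hφ hψ) (fun x _ => (hφ.1.differentiable (by simp)) x)
    (fun x _ => (hψ.1.differentiable (by simp)) x)

theorem IsTest.toL2_laplacian_inner {φ : EuclideanSpace ℝ (Fin n) → ℝ} (hφ : IsTest Ω φ)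
    (u : L2 Ω) : inner ℝ u hφ.laplacian.toL2 = ∑ i, inner ℝ u ((hφ.pd i).pd i).toL2 := by
  simp only [IsTest.inner_toL2]
  rw [← integral_finsetSum _ fun i _ => integrable_mul_memLp u ((hφ.pd i).pd i).memLp]
  simp only [hφ.laplacian_eq, Finset.mul_sum]

/-- Elements of `H¹₀` have their recorded gradient as weak gradient. -/
theorem inner_laplacian_of_mem_H10Graph {z : L2 Ω × (Fin n → L2 Ω)} (hz : z ∈ H10Graph Ω)
    {φ : EuclideanSpace ℝ (Fin n) → ℝ} (hφ : IsTest Ω φ) :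
    inner ℝ z.1 hφ.laplacian.toL2 = -∑ i, inner ℝ (z.2 i) (hφ.pd i).toL2 := by
  refine H10Graph_induction (P := fun z => inner ℝ z.1 hφ.laplacian.toL2
    = -∑ i, inner ℝ (z.2 i) (hφ.pd i).toL2) ?_ (fun ψ hψ => ?_) hz
  · exact isClosed_eq (by fun_prop) (by fun_prop)
  · simp only
    rw [hφ.toL2_laplacian_inner, ← Finset.sum_neg_distrib]
    refine Finset.sum_congr rfl fun i _ => ?_
    rw [inner_toL2_toL2, inner_toL2_toL2, integral_mul_pd hψ (hφ.pd i)]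

/-- Energy identity for a distributional solution of `Δu = F` in `H¹₀`. -/
theorem sum_norm_sq_of_laplacian {u F : L2 Ω} {g : Fin n → L2 Ω} (hu : (u, g) ∈ H10Graph Ω)
    (h : ∀ φ (hφ : IsTest Ω φ), inner ℝ u hφ.laplacian.toL2 = inner ℝ F hφ.toL2) :
    ∑ i, ‖g i‖ ^ 2 = -inner ℝ F u := by
  -- Both sides are continuous in the pair `(v, ∇v)`, so the identity extends by density from test
  -- functions to `H¹₀`, and in particular to `u` itself.
  have key : ∀ z ∈ H10Graph Ω, ∑ i, inner ℝ (g i) (z.2 i) = -inner ℝ F z.1 := by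
    intro z hz
    refine H10Graph_induction (P := fun z => ∑ i, inner ℝ (g i) (z.2 i) = -inner ℝ F z.1)
      ?_ (fun φ hφ => ?_) hz
    · exact isClosed_eq (by fun_prop) (by fun_prop)
    · simp only
      rw [← h φ hφ, inner_laplacian_of_mem_H10Graph hu hφ, neg_neg]
  simpa [real_inner_self_eq_norm_sq] using key _ hu

/-- Read as `Δu = (u - v)/ε`, the equation exhibits the Laplacian as an `L²` function; every
compactness and energy bound for controls uses this form. -/
theorem helmholtzEq_iff {ε : ℝ} {u v : L2 Ω} : HelmholtzEq Ω ε u v ↔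
    ∀ φ (hφ : IsTest Ω φ), inner ℝ u hφ.laplacian.toL2
      = inner ℝ ((1 / ε) • (u - v)) hφ.toL2 := by
  refine forall₂_congr fun φ hφ => ?_
  have h1 : ∫ x in Ω, (-(u x * Laplacian.laplacian φ x) + (1 / ε) * u x * φ x)
      = -inner ℝ u hφ.laplacian.toL2 + (1 / ε) * inner ℝ u hφ.toL2 := by
    rw [hφ.inner_toL2, hφ.laplacian.inner_toL2, ← integral_neg, ← integral_const_mul,
      ← integral_add (integrable_mul_memLp u hφ.laplacian.memLp).fun_neg
        ((integrable_mul_memLp u hφ.memLp).const_mul _)]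
    simp only [mul_assoc]
  have h2 : ∫ x in Ω, (1 / ε) * v x * φ x = (1 / ε) * inner ℝ v hφ.toL2 := by
    rw [hφ.inner_toL2, ← integral_const_mul]
    simp only [mul_assoc]
  rw [h1, h2, inner_smul_left, inner_sub_left]
  simp only [conj_trivial]
  constructor <;> intro h <;> linarith

/-- The `H⁻¹` requirement in `U_ad` is thus automatic and need not be followed through limits. -/
theorem HelmholtzEq.laplacianMemHneg1 {ε : ℝ} {u v : L2 Ω} (h : HelmholtzEq Ω ε u v) :
    LaplacianMemHneg1 Ω u := by
  refine ⟨‖(1 / ε) • (u - v)‖, fun φ hφ => ?_⟩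
  rw [← hφ.laplacian.inner_toL2, helmholtzEq_iff.1 h φ hφ]
  refine (abs_real_inner_le_norm _ _).trans (mul_le_mul_of_nonneg_left ?_ (norm_nonneg _))
  refine Real.le_sqrt_of_sq_le ?_
  have h1 : ‖hφ.toL2‖ ^ 2 = ∫ x in Ω, φ x ^ 2 := by
    rw [norm_sq_eq_integral]
    refine integral_congr_ae ?_
    filter_upwards [hφ.coeFn_toL2] with x hx
    rw [hx]
  rw [h1]
  exact le_add_of_nonneg_right (Finset.sum_nonneg fun i _ => integral_nonneg fun x => sq_nonneg _)

/-- `U_ad` is closed under weak limits of bounded families. -/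
theorem Uad_of_weakTendsto {X : Set (L2 Ω)} (hX : X = Set.univ ∨ X = H10 Ω) {ε M : ℝ}
    {ι : Type*} {l : Filter ι} [l.NeBot] {u : ι → L2 Ω} {u₀ : L2 Ω} (hu : WeakTendsto u l u₀)
    {B : ℝ} (hB : ∀ k, ‖u k‖ ≤ B) (hU : ∀ k, u k ∈ Uad Ω X ε M) : u₀ ∈ Uad Ω X ε M := by
  -- Along an ultrafilter all bounded families, here the `v k` and the gradients, converge weakly at
  -- once, without successive subsequences.
  set 𝒰 := Ultrafilter.of l
  have hu' : WeakTendsto u 𝒰 u₀ := hu.mono (Ultrafilter.of_le l)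
  choose hX' _ v hvM hv using hU
  obtain ⟨v₀, hv₀, hvlim⟩ := exists_weakTendsto_ultrafilter v 𝒰
    (fun k => mem_closedBall_zero_iff.1 (hvM k))
  have heq : HelmholtzEq Ω ε u₀ v₀ := by
    rw [helmholtzEq_iff]
    intro φ hφ
    refine tendsto_nhds_unique (hu' hφ.laplacian.toL2) ?_
    simp only [helmholtzEq_iff.1 (hv _) φ hφ, inner_smul_left]
    exact ((hu'.sub hvlim) hφ.toL2).const_mul _
  refine ⟨?_, heq.laplacianMemHneg1, v₀, mem_closedBall_zero_iff.2 hv₀, heq⟩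
  rcases hX with rfl | rfl
  · trivial
  choose g hg using hX'
  -- The energy identity bounds the squared norm by `Q`; the bound `Q + 1` on the norm avoids a
  -- square root, since `2t ≤ t² + 1`.
  have hgB : ∀ k i, ‖g k i‖ ≤ ‖1 / ε‖ * (B + M) * B + 1 := by
    intro k i
    have h1 := sum_norm_sq_of_laplacian (hg k) (helmholtzEq_iff.1 (hv k))
    have h2 : ‖g k i‖ ^ 2 ≤ ∑ j, ‖g k j‖ ^ 2 :=
      Finset.single_le_sum (f := fun j => ‖g k j‖ ^ 2) (fun j _ => sq_nonneg _)
        (Finset.mem_univ i)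
    have h3 : ‖(1 / ε) • (u k - v k)‖ ≤ ‖1 / ε‖ * (B + M) := by
      rw [norm_smul]
      gcongr
      exact (norm_sub_le _ _).trans (add_le_add (hB k) (mem_closedBall_zero_iff.1 (hvM k)))
    have h4 := (abs_le.1 (abs_real_inner_le_norm ((1 / ε) • (u k - v k)) (u k))).1
    have h5 : ‖(1 / ε) • (u k - v k)‖ * ‖u k‖ ≤ ‖1 / ε‖ * (B + M) * B :=
      mul_le_mul h3 (hB k) (norm_nonneg _) ((norm_nonneg _).trans h3)
    nlinarith [sq_nonneg (‖g k i‖ - 1), norm_nonneg (g k i)]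
  choose g₀ _ hg₀ using fun i => exists_weakTendsto_ultrafilter (fun k => g k i) 𝒰
    (fun k => hgB k i)
  exact ⟨g₀, H10Graph_of_weakTendsto hu' hg₀ hg⟩

end Sobolev

/-! ### Weak limits in the state equation -/

section StateEquation

variable {n : ℕ} {Ω : Set (EuclideanSpace ℝ (Fin n))}

/-- Multiplication of an `L²` function by an essentially bounded function. -/
def mulL2 {b : EuclideanSpace ℝ (Fin n) → ℝ} (hb : MemLp b ⊤ (volume.restrict Ω)) (h : L2 Ω) :
    L2 Ω :=
  (MemLp.mul' (p := ⊤) (q := 2) (r := 2) (Lp.memLp h) hb).toLp (fun x => b x * h x)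

theorem coeFn_mulL2 {b : EuclideanSpace ℝ (Fin n) → ℝ} (hb : MemLp b ⊤ (volume.restrict Ω))
    (h : L2 Ω) : mulL2 hb h =ᵐ[volume.restrict Ω] fun x => b x * h x :=
  MemLp.coeFn_toLp _

theorem inner_mulL2 {b : EuclideanSpace ℝ (Fin n) → ℝ} (hb : MemLp b ⊤ (volume.restrict Ω))
    (u h : L2 Ω) : inner ℝ u (mulL2 hb h) = ∫ x in Ω, u x * (b x * h x) :=
  inner_toLp u _

theorem exists_norm_mulL2_le {b : EuclideanSpace ℝ (Fin n) → ℝ}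
    (hb : MemLp b ⊤ (volume.restrict Ω)) : ∃ C, 0 ≤ C ∧ ∀ h : L2 Ω, ‖mulL2 hb h‖ ≤ C * ‖h‖ := by
  refine ⟨(eLpNormEssSup b (volume.restrict Ω)).toReal, ENNReal.toReal_nonneg, fun h => ?_⟩
  refine Lp.norm_le_mul_norm_of_ae_le_mul ?_
  have h1 := ae_le_eLpNormEssSup (f := b) (μ := volume.restrict Ω)
  filter_upwards [coeFn_mulL2 hb h, h1] with x hx hx1
  rw [hx, norm_mul]
  gcongr
  have h2 : eLpNormEssSup b (volume.restrict Ω) ≠ ⊤ := by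
    have := hb.2.ne
    rwa [eLpNorm_exponent_top] at this
  have := ENNReal.toReal_mono h2 hx1
  simpa using this

variable {a : Fin n → Fin n → EuclideanSpace ℝ (Fin n) → ℝ} {c₀ : EuclideanSpace ℝ (Fin n) → ℝ}

theorem integral_form_eq (ha : ∀ i j, MemLp (a i j) ⊤ (volume.restrict Ω))
    (hc₀ : MemLp c₀ ⊤ (volume.restrict Ω)) (y v : L2 Ω) (g h : Fin n → L2 Ω) :
    ∫ x in Ω, ((∑ i, ∑ j, a i j x * g j x * h i x) + c₀ x * y x * v x)
      = (∑ i, ∑ j, inner ℝ (g j) (mulL2 (ha i j) (h i))) + inner ℝ y (mulL2 hc₀ v) := by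
  have hint : ∀ {b : EuclideanSpace ℝ (Fin n) → ℝ} (hb : MemLp b ⊤ (volume.restrict Ω))
      (u w : L2 Ω), Integrable (fun x => b x * u x * w x) (volume.restrict Ω) := by
    intro b hb u w
    refine (integrable_mul_memLp u (Lp.memLp (mulL2 hb w))).congr ?_
    filter_upwards [coeFn_mulL2 hb w] with x hx
    rw [hx]
    ring
  have hval : ∀ {b : EuclideanSpace ℝ (Fin n) → ℝ} (hb : MemLp b ⊤ (volume.restrict Ω))
      (u w : L2 Ω), ∫ x in Ω, b x * u x * w x = inner ℝ u (mulL2 hb w) := by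
    intro b hb u w
    rw [inner_mulL2]
    refine integral_congr_ae (Eventually.of_forall fun x => ?_)
    ring
  rw [integral_add (integrable_finsetSum _ fun i _ => integrable_finsetSum _ fun j _ =>
    hint (ha i j) _ _) (hint hc₀ y v), integral_finsetSum _ fun i _ =>
    integrable_finsetSum _ fun j _ => hint (ha i j) _ _, hval hc₀]
  congr 1
  refine Finset.sum_congr rfl fun i _ => ?_
  rw [integral_finsetSum _ fun j _ => hint (ha i j) _ _]
  exact Finset.sum_congr rfl fun j _ => hval (ha i j) _ _

/-- Pointwise ellipticity is applied to the vector `ξ = (g i x)ᵢ` and integrated. -/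
theorem sum_norm_sq_le_form (ha : ∀ i j, MemLp (a i j) ⊤ (volume.restrict Ω)) {σ : ℝ}
    (hell : ∀ᵐ x ∂(volume.restrict Ω), ∀ ξ : EuclideanSpace ℝ (Fin n),
      σ * ‖ξ‖ ^ 2 ≤ ∑ i, ∑ j, a i j x * ξ i * ξ j) (g : Fin n → L2 Ω) :
    σ * ∑ i, ‖g i‖ ^ 2 ≤ ∑ i, ∑ j, inner ℝ (g j) (mulL2 (ha i j) (g i)) := by
  have hval : ∀ i j, inner ℝ (g j) (mulL2 (ha i j) (g i))
      = ∫ x in Ω, g j x * mulL2 (ha i j) (g i) x := fun i j => inner_eq_integral _ _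
  have hint : ∀ i j, Integrable (fun x => g j x * mulL2 (ha i j) (g i) x) (volume.restrict Ω) :=
    fun i j => integrable_mul_memLp _ (Lp.memLp _)
  have h1 : ∑ i, ∑ j, inner ℝ (g j) (mulL2 (ha i j) (g i))
      = ∫ x in Ω, ∑ i, ∑ j, g j x * mulL2 (ha i j) (g i) x := by
    rw [integral_finsetSum _ fun i _ => integrable_finsetSum _ fun j _ => hint i j]
    refine Finset.sum_congr rfl fun i _ => ?_
    rw [integral_finsetSum _ fun j _ => hint i j]
    exact Finset.sum_congr rfl fun j _ => hval i j
  have h2 : σ * ∑ i, ‖g i‖ ^ 2 = ∫ x in Ω, σ * ∑ i, g i x ^ 2 := by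
    rw [integral_const_mul, integral_finsetSum _ fun i _ => (Lp.memLp (g i)).integrable_sq]
    simp only [norm_sq_eq_integral]
  rw [h1, h2]
  refine integral_mono_ae ((integrable_finsetSum _ fun i _ =>
    (Lp.memLp (g i)).integrable_sq).const_mul _)
    (integrable_finsetSum _ fun i _ => integrable_finsetSum _ fun j _ => hint i j) ?_
  have h3 : ∀ᵐ x ∂(volume.restrict Ω), ∀ i j, mulL2 (ha i j) (g i) x = a i j x * g i x :=
    ae_all_iff.2 fun i => ae_all_iff.2 fun j => coeFn_mulL2 _ _
  filter_upwards [hell, h3] with x hx hx3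
  have := hx (WithLp.toLp 2 fun i => g i x)
  rw [EuclideanSpace.norm_sq_eq] at this
  simp only [Real.norm_eq_abs, sq_abs] at this
  refine this.trans (le_of_eq ?_)
  refine Finset.sum_congr rfl fun i _ => Finset.sum_congr rfl fun j _ => ?_
  rw [hx3]
  ring

/-- Bounded weak solutions with weakly convergent right-hand sides have a weak solution of the
limit equation as weak limit. -/
theorem exists_isWeakSolution_limit (ha : ∀ i j, MemLp (a i j) ⊤ (volume.restrict Ω))
    (hc₀ : MemLp c₀ ⊤ (volume.restrict Ω)) {σ : ℝ} (hσ : 0 < σ)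
    (hell : ∀ᵐ x ∂(volume.restrict Ω), ∀ ξ : EuclideanSpace ℝ (Fin n),
      σ * ‖ξ‖ ^ 2 ≤ ∑ i, ∑ j, a i j x * ξ i * ξ j)
    {ι : Type*} {𝒰 : Ultrafilter ι} {y w : ι → L2 Ω} {w₀ : L2 Ω} (hw : WeakTendsto w 𝒰 w₀)
    {B : ℝ} (hyB : ∀ k, ‖y k‖ ≤ B) (hwB : ∀ k, ‖w k‖ ≤ B)
    (h : ∀ k, IsWeakSolution Ω a c₀ (y k) (w k)) :
    ∃ y₀, WeakTendsto y 𝒰 y₀ ∧ IsWeakSolution Ω a c₀ y₀ w₀ := by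
  choose g hg heq using h
  simp only [integral_form_eq ha hc₀, ← inner_eq_integral] at heq
  obtain ⟨C, hC0, hC⟩ := exists_norm_mulL2_le hc₀
  obtain ⟨y₀, -, hy₀⟩ := exists_weakTendsto_ultrafilter y 𝒰 hyB
  -- The equation is tested with its own solution. As `c₀` has no sign, its term is absorbed by the
  -- assumed `L²` bound on the states.
  have hgB : ∀ k i, ‖g k i‖ ≤ (B * B + B * (C * B)) / σ + 1 := by
    intro k i
    have hB0 : 0 ≤ B := (norm_nonneg _).trans (hyB k)
    have h1 := heq k (y k) (g k) (hg k)
    have h2 := sum_norm_sq_le_form ha hell (g k)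
    have h3 : inner ℝ (w k) (y k) ≤ B * B :=
      (real_inner_le_norm _ _).trans (mul_le_mul (hwB k) (hyB k) (norm_nonneg _) hB0)
    have h4 : -inner ℝ (y k) (mulL2 hc₀ (y k)) ≤ B * (C * B) := by
      refine (neg_le_abs _).trans ((abs_real_inner_le_norm _ _).trans ?_)
      exact mul_le_mul (hyB k) ((hC _).trans (mul_le_mul_of_nonneg_left (hyB k) hC0))
        (norm_nonneg _) hB0
    have h5 : ‖g k i‖ ^ 2 ≤ ∑ j, ‖g k j‖ ^ 2 :=
      Finset.single_le_sum (f := fun j => ‖g k j‖ ^ 2) (fun j _ => sq_nonneg _)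
        (Finset.mem_univ i)
    have h6 : ‖g k i‖ ^ 2 ≤ (B * B + B * (C * B)) / σ := by
      rw [le_div_iff₀ hσ]
      nlinarith
    nlinarith [sq_nonneg (‖g k i‖ - 1), norm_nonneg (g k i)]
  choose g₀ _ hg₀ using fun i => exists_weakTendsto_ultrafilter (fun k => g k i) 𝒰
    (fun k => hgB k i)
  refine ⟨y₀, hy₀, g₀, H10Graph_of_weakTendsto hy₀ hg₀ hg, fun v q hv => ?_⟩
  rw [integral_form_eq ha hc₀, ← inner_eq_integral]
  refine tendsto_nhds_unique ?_ (hw v)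
  simp only [← heq _ v q hv]
  exact (tendsto_finsetSum _ fun i _ => tendsto_finsetSum _ fun j _ => hg₀ j _).add (hy₀ _)

theorem memLp_top_of_lipschitzOnWith (hΩ : IsOpen Ω) (hΩb : Bornology.IsBounded Ω)
    {b : EuclideanSpace ℝ (Fin n) → ℝ} {K : NNReal} (hb : LipschitzOnWith K b (closure Ω)) :
    MemLp b ⊤ (volume.restrict Ω) := by
  obtain ⟨C, hC⟩ := hΩb.isCompact_closure.exists_bound_of_continuousOn hb.continuousOn
  refine memLp_top_of_bound
    ((hb.continuousOn.mono subset_closure).aestronglyMeasurable hΩ.measurableSet) C ?_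
  exact ae_restrict_of_forall_mem hΩ.measurableSet fun x hx => hC x (subset_closure hx)

end StateEquation

end SparseControl

namespace SparseControl

/-! ### Estimates for the Huber function and fractional powers -/

section Huber

variable {p γ : ℝ}

/-- For `|v| ≤ 1/γ` the function is `|v|` times `(γ|v|)^(p-1)/p ≤ 1`; otherwise it is `|v|` lowered
by `(p-1)/(pγ) ≤ 1/γ`. -/
theorem huber_bounds (hp : 1 < p) (hγ : 0 < γ) (v : ℝ) :
    0 ≤ huber p γ v ∧ huber p γ v ≤ |v| ∧ |v| ≤ huber p γ v + 1 / γ := by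
  have hp0 : 0 < p := by linarith
  have hg : 0 < 1 / γ := by positivity
  unfold huber
  split_ifs with h
  · have hv : |v| ≤ 1 / γ := abs_le.2 h
    have h0 : 0 ≤ γ ^ (p - 1) / p * |v| ^ p := by positivity
    refine ⟨h0, ?_, by linarith⟩
    rcases (abs_nonneg v).eq_or_lt with hv0 | hv0
    · rw [← hv0, Real.zero_rpow hp0.ne', mul_zero]
    have h1 : |v| ^ p = |v| ^ (p - 1) * |v| := by
      rw [← Real.rpow_add_one hv0.ne', sub_add_cancel]
    have h2 : γ ^ (p - 1) * |v| ^ (p - 1) ≤ 1 := by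
      rw [← Real.mul_rpow hγ.le (abs_nonneg v)]
      refine Real.rpow_le_one (by positivity) ?_ (by linarith)
      rw [mul_comm]
      exact (le_div_iff₀ hγ).1 hv
    rw [h1, div_mul_eq_mul_div, div_le_iff₀ hp0]
    nlinarith
  · have hv : 1 / γ < |v| := by
      by_contra hn
      exact h (abs_le.1 (not_lt.1 hn))
    have h1 : 1 / γ * ((1 - p) / p) = -(1 / γ * ((p - 1) / p)) := by ring
    have h2 : (p - 1) / p ≤ 1 := (div_le_one hp0).2 (by linarith)
    have h3 : 0 ≤ (p - 1) / p := div_nonneg (by linarith) hp0.le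
    rw [h1]
    refine ⟨?_, ?_, ?_⟩ <;> nlinarith [mul_nonneg hg.le h3]

theorem measurable_huber (p γ : ℝ) : Measurable (huber p γ) :=
  Measurable.ite measurableSet_Icc (by fun_prop) (by fun_prop)

theorem rpow_le_add_of_le_add {q a b c : ℝ} (hq : 0 ≤ q) (hq1 : q ≤ 1) (ha : 0 ≤ a) (hb : 0 ≤ b)
    (hc : 0 ≤ c) (h : a ≤ b + c) : a ^ q ≤ b ^ q + c ^ q :=
  (Real.rpow_le_rpow ha h hq).trans (Real.rpow_add_le_add_rpow hb hc hq hq1)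

/-- Splitting at the level `s`: values below it contribute at most `s^q`, values above it are
controlled by `t²` because `q - 2 ≤ 0`. Small and large levels play different roles later. -/
theorem rpow_abs_le {q s : ℝ} (hq : 0 ≤ q) (hq2 : q ≤ 2) (hs : 0 < s) (t : ℝ) :
    |t| ^ q ≤ s ^ q + s ^ (q - 2) * t ^ 2 := by
  rcases le_total |t| s with h | h
  · have := Real.rpow_le_rpow (abs_nonneg t) h hq
    have : 0 ≤ s ^ (q - 2) * t ^ 2 := by positivity
    linarith
  · have ht : 0 < |t| := hs.trans_le h
    have h1 : |t| ^ q = |t| ^ (q - 2) * t ^ 2 := by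
      rw [← sq_abs t, ← Real.rpow_two, ← Real.rpow_add ht, sub_add_cancel]
    have h2 : |t| ^ (q - 2) ≤ s ^ (q - 2) :=
      Real.rpow_le_rpow_of_nonpos hs h (by linarith)
    have h3 : 0 ≤ s ^ q := by positivity
    rw [h1]
    nlinarith [sq_nonneg t]

end Huber

/-! ### Continuity of `Υ_p` and its regularization -/

section Upsilon

variable {n : ℕ} {Ω : Set (EuclideanSpace ℝ (Fin n))} {p : ℝ}

theorem integrable_rpow [IsFiniteMeasure (volume.restrict Ω)] (hp : 1 < p) (u : L2 Ω) :
    Integrable (fun x => |u x| ^ (1 / p)) (volume.restrict Ω) := by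
  have hq : 0 ≤ 1 / p := by positivity
  have hq1 : 1 / p ≤ 1 := (div_le_one (by linarith)).2 hp.le
  refine ((integrable_const (1 : ℝ)).add (Lp.memLp u).integrable_sq).mono'
    ((Lp.stronglyMeasurable u).measurable.abs.pow_const _).aestronglyMeasurable
    (Eventually.of_forall fun x => ?_)
  rw [Real.norm_of_nonneg (by positivity)]
  simpa using rpow_abs_le hq (by linarith) one_pos (u x)

theorem Upsilon_le_add [IsFiniteMeasure (volume.restrict Ω)] (hp : 1 < p) (u w : L2 Ω) :
    Upsilon p u ≤ Upsilon p w + Upsilon p (u - w) := by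
  have hq : 0 ≤ 1 / p := by positivity
  have hq1 : 1 / p ≤ 1 := (div_le_one (by linarith)).2 hp.le
  unfold Upsilon
  rw [← integral_add (integrable_rpow hp w) (integrable_rpow hp (u - w))]
  refine integral_mono_ae (integrable_rpow hp u)
    ((integrable_rpow hp w).add (integrable_rpow hp (u - w))) ?_
  filter_upwards [Lp.coeFn_sub u w] with x hx
  rw [hx]
  refine rpow_le_add_of_le_add hq hq1 (abs_nonneg _) (abs_nonneg _) (abs_nonneg _) ?_
  have := abs_add_le (w x) (u x - w x)
  simpa using this

theorem Upsilon_neg (p : ℝ) (u : L2 Ω) : Upsilon p (-u) = Upsilon p u := by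
  refine integral_congr_ae ?_
  filter_upwards [Lp.coeFn_neg u] with x hx
  rw [hx, Pi.neg_apply, abs_neg]

/-- The gap is uniform in `u`, by subadditivity of `t ↦ t^(1/p)`, so `γ` and the control may vary
together in the limit. -/
theorem UpsilonReg_bounds [IsFiniteMeasure (volume.restrict Ω)] (hp : 1 < p) {γ : ℝ} (hγ : 0 < γ)
    (u : L2 Ω) : UpsilonReg p γ u ≤ Upsilon p u ∧
      Upsilon p u ≤ UpsilonReg p γ u + (volume.restrict Ω).real Set.univ * (1 / γ) ^ (1 / p) := by
  have hq : 0 ≤ 1 / p := by positivity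
  have hq1 : 1 / p ≤ 1 := (div_le_one (by linarith)).2 hp.le
  have hle : ∀ x, huber p γ (u x) ^ (1 / p) ≤ |u x| ^ (1 / p) := fun x =>
    Real.rpow_le_rpow (huber_bounds hp hγ _).1 (huber_bounds hp hγ _).2.1 hq
  have hi : Integrable (fun x => huber p γ (u x) ^ (1 / p)) (volume.restrict Ω) := by
    refine (integrable_rpow hp u).mono' (((measurable_huber p γ).comp
      (Lp.stronglyMeasurable u).measurable).pow_const _).aestronglyMeasurable
      (Eventually.of_forall fun x => ?_)
    rw [Real.norm_of_nonneg (Real.rpow_nonneg (huber_bounds hp hγ _).1 _)]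
    exact hle x
  refine ⟨integral_mono hi (integrable_rpow hp u) hle, ?_⟩
  unfold Upsilon UpsilonReg
  rw [← smul_eq_mul, ← integral_const, ← integral_add hi (integrable_const _)]
  exact integral_mono (integrable_rpow hp u) (hi.add (integrable_const _)) fun x =>
    rpow_le_add_of_le_add hq hq1 (abs_nonneg _) (huber_bounds hp hγ _).1 (by positivity)
      (huber_bounds hp hγ _).2.2

theorem Upsilon_nonneg (p : ℝ) (u : L2 Ω) : 0 ≤ Upsilon p u :=
  integral_nonneg fun _ => Real.rpow_nonneg (abs_nonneg _) _

theorem UpsilonReg_nonneg (hp : 1 < p) {γ : ℝ} (hγ : 0 < γ) (u : L2 Ω) : 0 ≤ UpsilonReg p γ u :=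
  integral_nonneg fun _ => Real.rpow_nonneg (huber_bounds hp hγ _).1 _

theorem tendsto_UpsilonReg [IsFiniteMeasure (volume.restrict Ω)] (hp : 1 < p) {ι : Type*}
    {l : Filter ι} {γ : ι → ℝ} (hγ : ∀ k, 0 < γ k) (hγl : Tendsto γ l atTop) {u : ι → L2 Ω}
    {c : ℝ} (hu : Tendsto (fun k => Upsilon p (u k)) l (𝓝 c)) :
    Tendsto (fun k => UpsilonReg p (γ k) (u k)) l (𝓝 c) := by
  have h1 : Tendsto (fun k => (1 / γ k) ^ (1 / p)) l (𝓝 0) := by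
    have hq : 0 < 1 / p := by positivity
    have h2 : Tendsto (fun k => 1 / γ k) l (𝓝 0) := by
      simpa [Function.comp_def] using tendsto_inv_atTop_zero.comp hγl
    have h3 := h2.rpow_const (p := 1 / p) (Or.inr hq.le)
    rwa [Real.zero_rpow hq.ne'] at h3
  have h3 := hu.sub (h1.const_mul ((volume.restrict Ω).real Set.univ))
  rw [mul_zero, sub_zero] at h3
  refine tendsto_of_tendsto_of_tendsto_of_le_of_le h3 hu (fun k => ?_) fun k =>
    (UpsilonReg_bounds hp (hγ k) (u k)).1
  have := (UpsilonReg_bounds hp (hγ k) (u k)).2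
  simp only
  linarith

/-- A smooth cut-off function equal to one on a compact subset of an open set. -/
theorem exists_isTest_eq_one (hΩ : IsOpen Ω) {K : Set (EuclideanSpace ℝ (Fin n))}
    (hK : IsCompact K) (hKΩ : K ⊆ Ω) : ∃ χ, IsTest Ω χ ∧ ∀ x ∈ K, χ x = 1 := by
  obtain ⟨L, hL, hKL, hLΩ⟩ := exists_compact_between hK hΩ hKΩ
  obtain ⟨f, hf, -, hs, h1⟩ := exists_contMDiff_support_eq_eq_one_iff
    (modelWithCornersSelf ℝ (EuclideanSpace ℝ (Fin n))) (n := ⊤) isOpen_interior hK.isClosed hKL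
  have hsub : tsupport f ⊆ L := by
    rw [tsupport, hs]
    exact closure_minimal interior_subset hL.isClosed
  exact ⟨f, ⟨hf.contDiff, hL.of_isClosed_subset (isClosed_tsupport f) hsub, hsub.trans hLΩ⟩,
    fun x hx => (h1 x).1 hx⟩

/-- A bounded family that tends to zero locally in `L²` tends to zero with respect to `Υ_p`. -/
theorem tendsto_Upsilon_zero (hΩ : IsOpen Ω) (hΩb : Bornology.IsBounded Ω) (hp : 1 < p)
    {ι : Type*} {l : Filter ι} {d : ι → L2 Ω} {B : ℝ} (hd : ∀ k, ‖d k‖ ≤ B)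
    (h : ∀ χ, IsTest Ω χ → Tendsto (fun k => ∫ x in Ω, (d k x * χ x) ^ 2) l (𝓝 0)) :
    Tendsto (fun k => Upsilon p (d k)) l (𝓝 0) := by
  have hfin : volume Ω ≠ ⊤ := hΩb.measure_lt_top.ne
  have : IsFiniteMeasure (volume.restrict Ω) := ⟨by simpa using hΩb.measure_lt_top⟩
  have hq0 : 0 < 1 / p := by positivity
  have hq1 : 1 / p ≤ 1 := (div_le_one (by linarith)).2 hp.le
  set q := 1 / p
  set m := (volume.restrict Ω).real Set.univ
  rw [Metric.tendsto_nhds]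
  intro δ hδ
  have hδ4 : 0 < δ / 4 := by positivity
  obtain ⟨T, hT, hT0⟩ : ∃ T : ℝ, T ^ (q - 2) * B ^ 2 < δ / 4 ∧ 0 < T := by
    have h1 : Tendsto (fun T : ℝ => T ^ (q - 2) * B ^ 2) atTop (𝓝 0) := by
      have := (tendsto_rpow_neg_atTop (y := 2 - q) (by linarith)).mul_const (B ^ 2)
      simpa using this
    exact ((h1.eventually (gt_mem_nhds hδ4)).and (eventually_gt_atTop 0)).exists
  obtain ⟨s, hs, hs0⟩ : ∃ s : ℝ, m * s ^ q < δ / 4 ∧ 0 < s := by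
    have h1 : Tendsto (fun s : ℝ => m * s ^ q) (𝓝[>] 0) (𝓝 0) := by
      have h2 : Tendsto (fun s : ℝ => m * s ^ q) (𝓝 0) (𝓝 (m * 0 ^ q)) :=
        ((Real.continuous_rpow_const hq0.le).tendsto 0).const_mul m
      rw [Real.zero_rpow hq0.ne', mul_zero] at h2
      exact h2.mono_left nhdsWithin_le_nhds
    exact ((h1.eventually (gt_mem_nhds hδ4)).and self_mem_nhdsWithin).exists
  have hTq : 0 < T ^ q := Real.rpow_pos_of_pos hT0 q
  -- `K` is chosen after `T`: the large level `T` makes the quadratic tail small, and the remaining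
  -- set must then be small enough to offset `T ^ q`.
  obtain ⟨K, hKΩ, hK, hKm⟩ := hΩ.measurableSet.exists_isCompact_sdiff_lt hfin
    (ε := ENNReal.ofReal (δ / 4 / T ^ q)) (by simpa using div_pos hδ4 hTq)
  obtain ⟨χ, hχ, hχ1⟩ := exists_isTest_eq_one hΩ hK hKΩ
  have hKm' : (volume.restrict Ω).real Kᶜ < δ / 4 / T ^ q := by
    rw [measureReal_restrict_apply hK.measurableSet.compl, Set.inter_comm, ← Set.sdiff_eq]
    exact (ENNReal.lt_ofReal_iff_toReal_lt (measure_ne_top_of_subset Set.sdiff_subset hfin)).1 hKm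
  rw [lt_div_iff₀ hTq] at hKm'
  have hlim : Tendsto (fun k => s ^ (q - 2) * ∫ x in Ω, (d k x * χ x) ^ 2) l (𝓝 0) := by
    simpa using (h χ hχ).const_mul (s ^ (q - 2))
  filter_upwards [hlim.eventually (gt_mem_nhds hδ4)] with k hk
  rw [dist_zero_right, Real.norm_of_nonneg (Upsilon_nonneg _ _)]
  have i1 : Integrable (fun _ => s ^ q) (volume.restrict Ω) := integrable_const _
  have i2 : Integrable (fun x => s ^ (q - 2) * (d k x * χ x) ^ 2) (volume.restrict Ω) :=
    (((memLp_mul_test hΩ.measurableSet (d k) hχ).restrict Ω).integrable_sq).const_mul _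
  have i3 : Integrable (Kᶜ.indicator fun _ => T ^ q) (volume.restrict Ω) :=
    (integrable_const _).indicator hK.measurableSet.compl
  have i4 : Integrable (fun x => T ^ (q - 2) * (d k x) ^ 2) (volume.restrict Ω) :=
    (Lp.memLp (d k)).integrable_sq.const_mul _
  -- On `K`, where `χ = 1`, the splitting uses the small level `s` and local convergence; off `K` it
  -- uses the large level `T` and only the `L²` bound.
  have hmain : Upsilon p (d k) ≤ ∫ x in Ω, (((s ^ q + s ^ (q - 2) * (d k x * χ x) ^ 2)
      + Kᶜ.indicator (fun _ => T ^ q) x) + T ^ (q - 2) * (d k x) ^ 2) := by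
    refine integral_mono (integrable_rpow hp (d k)) (((i1.add i2).add i3).add i4) fun x => ?_
    have hsq : 0 ≤ s ^ q := by positivity
    have hsq2 : 0 ≤ s ^ (q - 2) * (d k x * χ x) ^ 2 := by positivity
    have hTq2 : 0 ≤ T ^ (q - 2) * (d k x) ^ 2 := by positivity
    by_cases hx : x ∈ K
    · have := rpow_abs_le hq0.le (by linarith) hs0 (d k x)
      simp only [Set.indicator_of_notMem (Set.notMem_compl_iff.2 hx), hχ1 x hx, mul_one] at *
      linarith
    · have := rpow_abs_le hq0.le (by linarith) hT0 (d k x)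
      simp only [Set.indicator_of_mem (Set.mem_compl hx)]
      linarith
  rw [integral_add ((i1.fun_add i2).fun_add i3) i4, integral_add (i1.fun_add i2) i3,
    integral_add i1 i2, integral_const, integral_const_mul, integral_const_mul,
    integral_indicator_const _ hK.measurableSet.compl, ← norm_sq_eq_integral, smul_eq_mul,
    smul_eq_mul] at hmain
  have hB : T ^ (q - 2) * ‖d k‖ ^ 2 ≤ T ^ (q - 2) * B ^ 2 := by
    have := hd k
    gcongr
  linarith

/-- Continuity of `Υ_p` under bounded, locally strong convergence. -/
theorem tendsto_Upsilon (hΩ : IsOpen Ω) (hΩb : Bornology.IsBounded Ω) (hp : 1 < p)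
    {ι : Type*} {l : Filter ι} {u : ι → L2 Ω} {u₀ : L2 Ω} {B : ℝ} (hd : ∀ k, ‖u k - u₀‖ ≤ B)
    (h : ∀ χ, IsTest Ω χ → Tendsto (fun k => ∫ x in Ω, ((u k - u₀) x * χ x) ^ 2) l (𝓝 0)) :
    Tendsto (fun k => Upsilon p (u k)) l (𝓝 (Upsilon p u₀)) := by
  have : IsFiniteMeasure (volume.restrict Ω) := ⟨by simpa using hΩb.measure_lt_top⟩
  have h0 := tendsto_Upsilon_zero (d := fun k => u k - u₀) hΩ hΩb hp hd h
  rw [tendsto_iff_dist_tendsto_zero]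
  refine squeeze_zero (fun _ => dist_nonneg) (fun k => ?_) h0
  have h1 := Upsilon_le_add hp (u k) u₀
  have h2 := Upsilon_le_add hp u₀ (u k)
  rw [← neg_sub, Upsilon_neg] at h2
  rw [Real.dist_eq, abs_le]
  constructor <;> linarith

end Upsilon

end SparseControl

namespace SparseControl

/-! ### Passing to the limit in the minimization -/

section Optimization

variable {n : ℕ} {Ω : Set (EuclideanSpace ℝ (Fin n))}

/-- The solution for `γ = 1` is a competitor for every `γ`, with regularized cost at most its
unregularized cost. States are bounded by the tracking term, not by coercivity of `A`. -/
theorem exists_bound_of_isSolution [IsFiniteMeasure (volume.restrict Ω)] {yd : L2 Ω}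
    {α β p : ℝ} (hα : 0 < α) (hβ : 0 < β) (hp : 1 < p) {F : Set (L2 Ω × L2 Ω)}
    {ybar ubar : ℝ → L2 Ω}
    (hsol : ∀ γ : ℝ, 0 < γ → IsSolution (costReg yd α β p γ) F (ybar γ, ubar γ)) :
    ∃ B, ∀ γ : ℝ, 0 < γ → ‖ybar γ‖ ≤ B ∧ ‖ubar γ‖ ≤ B := by
  set z₁ := (ybar 1, ubar 1)
  set C := cost yd α β p z₁
  refine ⟨max (‖yd‖ + (2 * C + 1)) (2 * C / α + 1), fun γ hγ => ?_⟩
  have h1 : costReg yd α β p γ (ybar γ, ubar γ) ≤ costReg yd α β p γ z₁ :=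
    (hsol γ hγ).2 (hsol 1 one_pos).1
  have h2 : costReg yd α β p γ z₁ ≤ C := by
    have := mul_le_mul_of_nonneg_left (UpsilonReg_bounds hp hγ z₁.2).1 hβ.le
    simp only [C, costReg, cost]
    linarith
  have h3 := mul_nonneg hβ.le (UpsilonReg_nonneg hp hγ (ubar γ))
  simp only [costReg] at h1 h2
  have h4 : 0 ≤ α / 2 * ‖ubar γ‖ ^ 2 := by positivity
  constructor
  · refine le_trans ?_ (le_max_left _ _)
    have h5 : ‖ybar γ‖ ≤ ‖yd‖ + ‖ybar γ - yd‖ := by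
      have := norm_add_le yd (ybar γ - yd)
      simpa using this
    nlinarith [sq_nonneg (‖ybar γ - yd‖ - 1), norm_nonneg (ybar γ - yd)]
  · refine le_trans ?_ (le_max_right _ _)
    have h5 : ‖ubar γ‖ ^ 2 ≤ 2 * C / α := by
      rw [le_div_iff₀ hα]
      nlinarith [sq_nonneg ‖ybar γ - yd‖]
    nlinarith [sq_nonneg (‖ubar γ‖ - 1), norm_nonneg (ubar γ)]

/-- An affine minorant of the regularized cost in the state variable. -/
theorem le_costReg (yd : L2 Ω) (α β p γ : ℝ) (y u y₀ : L2 Ω) :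
    1 / 2 * (2 * inner ℝ (y - yd) (y₀ - yd) - ‖y₀ - yd‖ ^ 2) + α / 2 * ‖u‖ ^ 2
      + β * UpsilonReg p γ u ≤ costReg yd α β p γ (y, u) := by
  have := norm_sub_sq_real (y - yd) (y₀ - yd)
  simp only [costReg]
  nlinarith [sq_nonneg ‖y - yd - (y₀ - yd)‖]

theorem tendsto_affine_minorant {ι : Type*} {l : Filter ι} {y : ι → L2 Ω} {y₀ : L2 Ω}
    (hy : WeakTendsto y l y₀) (yd : L2 Ω) :
    Tendsto (fun k => 1 / 2 * (2 * inner ℝ (y k - yd) (y₀ - yd) - ‖y₀ - yd‖ ^ 2)) l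
      (𝓝 (1 / 2 * ‖y₀ - yd‖ ^ 2)) := by
  have h1 := (((hy.sub (WeakTendsto.const yd) (y₀ - yd)).const_mul 2).sub_const
    (‖y₀ - yd‖ ^ 2)).const_mul (1 / 2)
  rw [real_inner_self_eq_norm_sq] at h1
  convert h1 using 2
  ring

theorem tendsto_costReg_const [IsFiniteMeasure (volume.restrict Ω)] {α β p : ℝ} (hp : 1 < p)
    {ι : Type*} {l : Filter ι} {γ : ι → ℝ} (hγ : ∀ k, 0 < γ k) (hγl : Tendsto γ l atTop)
    (yd : L2 Ω) (z : L2 Ω × L2 Ω) :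
    Tendsto (fun k => costReg yd α β p (γ k) z) l (𝓝 (cost yd α β p z)) :=
  ((tendsto_UpsilonReg hp hγ hγl (u := fun _ => z.2) tendsto_const_nhds).const_mul β).const_add _

variable {yd : L2 Ω} {α β p : ℝ} {ι : Type*} {l : Filter ι} {γ : ι → ℝ} {y u : ι → L2 Ω}
  {y₀ u₀ : L2 Ω}

/-- Linearizing the tracking term at `y₀` turns weak lower semicontinuity into convergence of a
lower bound for the costs. -/
theorem tendsto_minorant [IsFiniteMeasure (volume.restrict Ω)] (hp : 1 < p)
    (hγ : ∀ k, 0 < γ k) (hγl : Tendsto γ l atTop) (hy : WeakTendsto y l y₀)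
    (hu : Tendsto u l (𝓝 u₀)) (hΥ : Tendsto (fun k => Upsilon p (u k)) l (𝓝 (Upsilon p u₀))) :
    Tendsto (fun k => 1 / 2 * (2 * inner ℝ (y k - yd) (y₀ - yd) - ‖y₀ - yd‖ ^ 2)
      + α / 2 * ‖u k‖ ^ 2 + β * UpsilonReg p (γ k) (u k)) l (𝓝 (cost yd α β p (y₀, u₀))) :=
  ((tendsto_affine_minorant hy yd).add ((hu.norm.pow 2).const_mul (α / 2))).add
    ((tendsto_UpsilonReg hp hγ hγl hΥ).const_mul β)

/-- Limits of minimizers of the regularized costs minimize the limit cost. -/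
theorem isMinOn_cost_of_limit [IsFiniteMeasure (volume.restrict Ω)] [l.NeBot] (hp : 1 < p)
    (hγ : ∀ k, 0 < γ k) (hγl : Tendsto γ l atTop) (hy : WeakTendsto y l y₀)
    (hu : Tendsto u l (𝓝 u₀)) (hΥ : Tendsto (fun k => Upsilon p (u k)) l (𝓝 (Upsilon p u₀)))
    {F : Set (L2 Ω × L2 Ω)} (hF : ∀ k, IsMinOn (costReg yd α β p (γ k)) F (y k, u k)) :
    IsMinOn (cost yd α β p) F (y₀, u₀) := fun z hz =>
  le_of_tendsto_of_tendsto' (tendsto_minorant hp hγ hγl hy hu hΥ)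
    (tendsto_costReg_const hp hγ hγl yd z) fun k => (le_costReg ..).trans (hF k hz)

/-- The minimal regularized costs converge to the cost of any minimizer of the form `(y₁, u₀)`. -/
theorem tendsto_costReg_of_limit [IsFiniteMeasure (volume.restrict Ω)] [l.NeBot] (hp : 1 < p)
    (hγ : ∀ k, 0 < γ k) (hγl : Tendsto γ l atTop) (hy : WeakTendsto y l y₀)
    (hu : Tendsto u l (𝓝 u₀)) (hΥ : Tendsto (fun k => Upsilon p (u k)) l (𝓝 (Upsilon p u₀)))
    {F : Set (L2 Ω × L2 Ω)} (hF : ∀ k, IsMinOn (costReg yd α β p (γ k)) F (y k, u k))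
    (h₀ : (y₀, u₀) ∈ F) :
    Tendsto (fun k => costReg yd α β p (γ k) (y k, u k)) l (𝓝 (cost yd α β p (y₀, u₀))) :=
  tendsto_of_tendsto_of_tendsto_of_le_of_le (tendsto_minorant hp hγ hγl hy hu hΥ)
    (tendsto_costReg_const hp hγ hγl yd (y₀, u₀)) (fun _ => le_costReg ..) fun k => hF k h₀

/-- Optimality upgrades weak convergence of the controls to strong convergence. -/
theorem tendsto_control_of_weakTendsto [IsFiniteMeasure (volume.restrict Ω)] (hα : 0 < α)
    (hp : 1 < p) (hγ : ∀ k, 0 < γ k) (hγl : Tendsto γ l atTop) (hy : WeakTendsto y l y₀)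
    (hu : WeakTendsto u l u₀) (hΥ : Tendsto (fun k => Upsilon p (u k)) l (𝓝 (Upsilon p u₀)))
    {F : Set (L2 Ω × L2 Ω)} (hF : ∀ k, IsMinOn (costReg yd α β p (γ k)) F (y k, u k))
    (h₀ : (y₀, u₀) ∈ F) : Tendsto u l (𝓝 u₀) := by
  refine hu.tendsto_of_norm_sq_le fun δ hδ => ?_
  -- Optimality against `(y₀, u₀)`, solved for `‖u k‖²`, gives this upper bound, whose limit is
  -- `‖u₀‖²`.
  have h1 := (((tendsto_costReg_const (α := α) (β := β) hp hγ hγl yd (y₀, u₀)).sub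
    (tendsto_affine_minorant hy yd)).sub
    ((tendsto_UpsilonReg hp hγ hγl hΥ).const_mul β)).const_mul (2 / α)
  have h2 : 2 / α * (cost yd α β p (y₀, u₀) - 1 / 2 * ‖y₀ - yd‖ ^ 2 - β * Upsilon p u₀)
      = ‖u₀‖ ^ 2 := by
    simp only [cost]
    field_simp
    ring
  rw [h2] at h1
  filter_upwards [h1.eventually (gt_mem_nhds (lt_add_of_pos_right (‖u₀‖ ^ 2) hδ))] with k hk
  refine le_trans ?_ hk.le
  have h3 := (le_costReg yd α β p (γ k) (y k) (u k) y₀).trans (hF k h₀)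
  rw [div_mul_eq_mul_div, le_div_iff₀ hα]
  linarith

theorem IsSolution.isGLB {Z : Type} {J : Z → ℝ} {F : Set Z} {z : Z} (h : IsSolution J F z) :
    IsGLB (J '' F) (J z) :=
  ⟨by rintro _ ⟨w, hw, rfl⟩; exact h.2 hw, fun _ hb => hb ⟨z, h.1, rfl⟩⟩

end Optimization

/-! ### Convergence of `Υ_p` along the controls -/

section Compactness

variable {n : ℕ} {Ω : Set (EuclideanSpace ℝ (Fin n))}

/-- `Υ_p` is continuous along bounded weakly convergent sequences in `U_ad`. -/
theorem tendsto_Upsilon_of_mem_Uad (hΩ : IsOpen Ω) (hΩb : Bornology.IsBounded Ω) {p : ℝ}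
    (hp : 1 < p) {X : Set (L2 Ω)} {ε M : ℝ} {u : ℕ → L2 Ω} {u₀ : L2 Ω} {B : ℝ}
    (hB : ∀ k, ‖u k‖ ≤ B) (hu : WeakTendsto u atTop u₀) (hU : ∀ k, u k ∈ Uad Ω X ε M)
    (hU₀ : u₀ ∈ Uad Ω X ε M) :
    Tendsto (fun k => Upsilon p (u k)) atTop (𝓝 (Upsilon p u₀)) := by
  choose _ _ v hvM hv using hU
  obtain ⟨_, _, v₀, hv₀M, hv₀⟩ := hU₀
  have hd : ∀ k, ‖u k - u₀‖ ≤ B + ‖u₀‖ := fun k =>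
    (norm_sub_le _ _).trans (add_le_add_left (hB k) _)
  -- This is the distributional Laplacian of `u k - u₀`, bounded in `L²` though the `v k` need not
  -- converge.
  set f : ℕ → L2 Ω := fun k => (1 / ε) • ((u k - v k) - (u₀ - v₀)) with hf
  have hfB : ∀ k, ‖f k‖ ≤ ‖1 / ε‖ * ((B + M) + ‖u₀ - v₀‖) := fun k => by
    rw [hf, norm_smul]
    refine mul_le_mul_of_nonneg_left ?_ (norm_nonneg _)
    exact (norm_sub_le _ _).trans (add_le_add_left ((norm_sub_le _ _).trans
      (add_le_add (hB k) (mem_closedBall_zero_iff.1 (hvM k)))) _)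
  have hw : WeakTendsto (fun k => u k - u₀) atTop 0 := by
    simpa using hu.sub (WeakTendsto.const u₀)
  refine tendsto_Upsilon hΩ hΩb hp hd fun χ hχ => ?_
  refine tendsto_integral_cutoff_sq hΩ.measurableSet (F := f)
    (fun k => (hd k).trans (le_max_left _ _)) (fun k => (hfB k).trans (le_max_right _ _)) hw
    (fun k φ hφ => ?_) hχ
  rw [← hφ.laplacian.inner_toL2, ← hφ.inner_toL2, inner_sub_left,
    helmholtzEq_iff.1 (hv k) φ hφ, helmholtzEq_iff.1 hv₀ φ hφ, ← inner_sub_left, ← smul_sub]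

theorem tendsto_Upsilon_of_tendsto (hΩ : IsOpen Ω) (hΩb : Bornology.IsBounded Ω) {p : ℝ}
    (hp : 1 < p) {ι : Type*} {l : Filter ι} {u : ι → L2 Ω} {u₀ : L2 Ω} {B : ℝ}
    (hB : ∀ k, ‖u k‖ ≤ B) (hu : Tendsto u l (𝓝 u₀)) :
    Tendsto (fun k => Upsilon p (u k)) l (𝓝 (Upsilon p u₀)) := by
  refine tendsto_Upsilon (B := B + ‖u₀‖) hΩ hΩb hp
    (fun k => (norm_sub_le _ _).trans (add_le_add_left (hB k) _)) fun χ hχ => ?_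
  obtain ⟨C, -, hC⟩ := hχ.exists_bound
  have h1 : Tendsto (fun k => C ^ 2 * ‖u k - u₀‖ ^ 2) l (𝓝 0) := by
    simpa using ((tendsto_iff_norm_sub_tendsto_zero.1 hu).pow 2).const_mul (C ^ 2)
  exact squeeze_zero (fun k => integral_nonneg fun x => sq_nonneg _)
    (fun k => integral_mul_sq_le _ hC) h1

end Compactness

end SparseControl

end

/-! ### The convergence theorem -/

theorem theoremt {n : ℕ} (Ω : Set (EuclideanSpace ℝ (Fin n)))
    (hΩ : IsOpen Ω) (hΩb : Bornology.IsBounded Ω)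
    -- the coefficients of the elliptic operator
    (a : Fin n → Fin n → EuclideanSpace ℝ (Fin n) → ℝ)
    (ha : ∀ i j, ∃ K, LipschitzOnWith K (a i j) (closure Ω))
    (hasymm : ∀ i j, ∀ x ∈ closure Ω, a i j x = a j i x)
    (hell : ∃ σ : ℝ, 0 < σ ∧ ∀ᵐ x ∂(volume.restrict Ω), ∀ ξ : EuclideanSpace ℝ (Fin n),
      σ * ‖ξ‖ ^ 2 ≤ ∑ i, ∑ j, a i j x * ξ i * ξ j)
    (c₀ : EuclideanSpace ℝ (Fin n) → ℝ) (hc₀ : MemLp c₀ ⊤ (volume.restrict Ω))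
    -- the data of the control problem
    (f yd : SparseControl.L2 Ω) (α β p ε M : ℝ)
    (hα : 0 < α) (hβ : 0 < β) (hp : 1 < p) (hε : 0 < ε) (hM : 0 < M)
    -- `U_ad` without or with the homogeneous Dirichlet condition
    (X : Set (SparseControl.L2 Ω)) (hX : X = Set.univ ∨ X = SparseControl.H10 Ω)
    -- solutions `(ȳ_γ, ū_γ)` of the regularized problems
    (ybar ubar : ℝ → SparseControl.L2 Ω)
    (hsol : ∀ γ : ℝ, 0 < γ →
      SparseControl.IsSolution (SparseControl.costReg yd α β p γ)
        (SparseControl.Feasible Ω a c₀ f (SparseControl.Uad Ω X ε M)) (ybar γ, ubar γ)) :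
    -- a strongly convergent subsequence with limit in `U_ad` exists
    (∃ γ : ℕ → ℝ, (∀ k, 0 < γ k) ∧ Tendsto γ atTop atTop ∧
      ∃ ustar ∈ SparseControl.Uad Ω X ε M,
        Tendsto (fun k => ubar (γ k)) atTop (𝓝 ustar)) ∧
    -- the limit of any such subsequence solves the original problem
    (∀ γ : ℕ → ℝ, (∀ k, 0 < γ k) → Tendsto γ atTop atTop →
      ∀ ustar : SparseControl.L2 Ω, Tendsto (fun k => ubar (γ k)) atTop (𝓝 ustar) →
        ustar ∈ SparseControl.Uad Ω X ε M ∧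
        ∃ ystar : SparseControl.L2 Ω,
          SparseControl.IsSolution (SparseControl.cost yd α β p)
            (SparseControl.Feasible Ω a c₀ f (SparseControl.Uad Ω X ε M)) (ystar, ustar) ∧
          Tendsto (fun k => SparseControl.costReg yd α β p (γ k) (ybar (γ k), ubar (γ k)))
            atTop (𝓝 (SparseControl.cost yd α β p (ystar, ustar))) ∧
          IsGLB (SparseControl.cost yd α β p ''
              SparseControl.Feasible Ω a c₀ f (SparseControl.Uad Ω X ε M))
            (SparseControl.cost yd α β p (ystar, ustar)) ∧
          -- if the regularized problems were solved over all controls in `L²(Ω)`,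
          -- then so is the original one
          ((∀ k, SparseControl.IsSolution (SparseControl.costReg yd α β p (γ k))
              (SparseControl.Feasible Ω a c₀ f Set.univ) (ybar (γ k), ubar (γ k))) →
            SparseControl.IsSolution (SparseControl.cost yd α β p)
              (SparseControl.Feasible Ω a c₀ f Set.univ) (ystar, ustar) ∧
            IsGLB (SparseControl.cost yd α β p ''
                SparseControl.Feasible Ω a c₀ f Set.univ)
              (SparseControl.cost yd α β p (ystar, ustar)))) := by
  have : IsFiniteMeasure (volume.restrict Ω) := ⟨by simpa using hΩb.measure_lt_top⟩
  obtain ⟨σ, hσ, hell⟩ := hell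
  have ha' : ∀ i j, MemLp (a i j) ⊤ (volume.restrict Ω) := fun i j =>
    SparseControl.memLp_top_of_lipschitzOnWith hΩ hΩb (ha i j).choose_spec
  obtain ⟨B, hB⟩ := SparseControl.exists_bound_of_isSolution hα hβ hp hsol
  have state_limit : ∀ {ι : Type} (𝒰 : Ultrafilter ι) (γ : ι → ℝ), (∀ k, 0 < γ k) →
      ∀ u₀ : SparseControl.L2 Ω, SparseControl.WeakTendsto (fun k => ubar (γ k)) 𝒰 u₀ →
      ∃ y₀, SparseControl.WeakTendsto (fun k => ybar (γ k)) 𝒰 y₀ ∧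
        SparseControl.IsWeakSolution Ω a c₀ y₀ (u₀ + f) := by
    intro ι 𝒰 γ hγ u₀ hu₀
    refine SparseControl.exists_isWeakSolution_limit (B := B + ‖f‖) ha' hc₀ hσ hell
      (hu₀.add (SparseControl.WeakTendsto.const f))
      (fun k => (hB _ (hγ k)).1.trans (le_add_of_nonneg_right (norm_nonneg f)))
      (fun k => (norm_add_le _ _).trans (add_le_add_left (hB _ (hγ k)).2 _))
      fun k => (hsol _ (hγ k)).1.2
  constructor
  · have hpos : ∀ k : ℕ, (0 : ℝ) < k + 1 := fun k => by positivity
    have hlim : Tendsto (fun k : ℕ => (k : ℝ) + 1) atTop atTop :=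
      tendsto_atTop_add_const_right _ _ tendsto_natCast_atTop_atTop
    have : Fact ((2 : ENNReal) ≠ ⊤) := ⟨by norm_num⟩
    obtain ⟨u₀, φ, hφ, hu₀⟩ := SparseControl.exists_weakTendsto_subseq
      (fun k : ℕ => ubar (k + 1)) fun k => (hB _ (hpos k)).2
    have hγ : ∀ k, (0 : ℝ) < (φ k : ℝ) + 1 := fun k => hpos _
    have hγl : Tendsto (fun k => (φ k : ℝ) + 1) atTop atTop := hlim.comp hφ.tendsto_atTop
    have hU : ∀ k, ubar (φ k + 1) ∈ SparseControl.Uad Ω X ε M := fun k => (hsol _ (hγ k)).1.1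
    have hU₀ := SparseControl.Uad_of_weakTendsto hX hu₀ (fun k => (hB _ (hγ k)).2) hU
    have hΥ := SparseControl.tendsto_Upsilon_of_mem_Uad hΩ hΩb hp (fun k => (hB _ (hγ k)).2)
      hu₀ hU hU₀
    set 𝒰 := Ultrafilter.of (atTop : Filter ℕ)
    have h𝒰 : (𝒰 : Filter ℕ) ≤ atTop := Ultrafilter.of_le _
    obtain ⟨y₀, hy₀, hsol₀⟩ := state_limit 𝒰 (fun k => (φ k : ℝ) + 1) hγ u₀ (hu₀.mono h𝒰)
    have hstrong := SparseControl.tendsto_control_of_weakTendsto hα hp hγ (hγl.mono_left h𝒰) hy₀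
      (hu₀.mono h𝒰) (hΥ.mono_left h𝒰) (fun k => (hsol _ (hγ k)).2) ⟨hU₀, hsol₀⟩
    -- Strong convergence along an ultrafilter finer than `atTop` makes `u₀` a norm cluster point of
    -- the sequence, so a genuine subsequence converges.
    obtain ⟨ψ, hψ, hψlim⟩ := MapClusterPt.tendsto_subseq
      (hstrong.mapClusterPt.mono h𝒰)
    exact ⟨fun k => (φ (ψ k) : ℝ) + 1, fun k => hγ _, hγl.comp hψ.tendsto_atTop, u₀, hU₀, hψlim⟩
  · intro γ hγ hγl ustar hu
    have huB : ∀ k, ‖ubar (γ k)‖ ≤ B := fun k => (hB _ (hγ k)).2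
    have hU := SparseControl.Uad_of_weakTendsto hX (SparseControl.WeakTendsto.of_tendsto hu) huB
      fun k => (hsol _ (hγ k)).1.1
    have hΥ := SparseControl.tendsto_Upsilon_of_tendsto hΩ hΩb hp huB hu
    have hmin := fun k => (hsol _ (hγ k)).2
    have hlimit : ∀ 𝒰 : Ultrafilter ℕ, (𝒰 : Filter ℕ) ≤ atTop → ∃ y₀,
        SparseControl.WeakTendsto (fun k => ybar (γ k)) 𝒰 y₀ ∧
        SparseControl.IsSolution (SparseControl.cost yd α β p)
          (SparseControl.Feasible Ω a c₀ f (SparseControl.Uad Ω X ε M)) (y₀, ustar) := by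
      intro 𝒰 h𝒰
      obtain ⟨y₀, hy₀, hsol₀⟩ := state_limit 𝒰 γ hγ ustar
        (SparseControl.WeakTendsto.of_tendsto (hu.mono_left h𝒰))
      exact ⟨y₀, hy₀, ⟨hU, hsol₀⟩, SparseControl.isMinOn_cost_of_limit hp hγ (hγl.mono_left h𝒰)
        hy₀ (hu.mono_left h𝒰) (hΥ.mono_left h𝒰) hmin⟩
    have h𝒰₀ : (Ultrafilter.of (atTop : Filter ℕ) : Filter ℕ) ≤ atTop := Ultrafilter.of_le _
    obtain ⟨ystar, hy, hopt⟩ := hlimit _ h𝒰₀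
    refine ⟨hU, ystar, hopt, ?_, hopt.isGLB, fun hglobal => ?_⟩
    -- The states need not converge as a sequence. Each ultrafilter yields some optimal pair `(y₁,
    -- ustar)`, and optimality of both pairs makes their costs equal, so the whole sequence of costs
    -- converges.
    · rw [tendsto_iff_ultrafilter]
      intro 𝒰 h𝒰
      obtain ⟨y₁, hy₁, hopt₁⟩ := hlimit 𝒰 h𝒰
      have heq : SparseControl.cost yd α β p (ystar, ustar)
          = SparseControl.cost yd α β p (y₁, ustar) :=
        le_antisymm (hopt.2 hopt₁.1) (hopt₁.2 hopt.1)
      rw [heq]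
      exact SparseControl.tendsto_costReg_of_limit hp hγ (hγl.mono_left h𝒰) hy₁
        (hu.mono_left h𝒰) (hΥ.mono_left h𝒰) hmin hopt₁.1
    -- The limit inequality for minimizers holds over any fixed set of competitors; here it is all
    -- of `L²(Ω)`, with the same limit pair.
    · have hfull : SparseControl.IsSolution (SparseControl.cost yd α β p)
          (SparseControl.Feasible Ω a c₀ f Set.univ) (ystar, ustar) :=
        ⟨⟨trivial, hopt.1.2⟩, SparseControl.isMinOn_cost_of_limit hp hγ (hγl.mono_left h𝒰₀) hy
          (hu.mono_left h𝒰₀) (hΥ.mono_left h𝒰₀) fun k => (hglobal k).2⟩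
      exact ⟨hfull, hfull.isGLB⟩
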